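/- Let $n\ge 2$ and let the braid group $B_{n+1}$ on $n+1$ strands, with standard generators $\sigma_1,\dots,\sigma_n$, act on $\mathbb{Z}^n$ (vectors $(k_1,\dots,k_n)$) through the linear representation $\rho$ given by $$\sigma_1:\ k_1\mapsto k_1,\quad k_j\mapsto k_j+k_1\ (j>1),\qquad \sigma_i:\ k_{i-1}\mapsto 2k_{i-1}-k_i,\quad k_i\mapsto k_{i-1},\quad k_j\mapsto k_j\ (j\ne i-1,i)\qquad(i>1),$$ and let ${\cal G}_n=\rho(B_{n+1})$. Put $x_i=k_i-k_{i-1}+\dots+(-1)^{i+1}k_1$ for $1\le i\le n$, $x_{n+1}=0$, and $p_i=x_{2i}$, $q_i=x_{2i-1}-x_{2i+1}$ for $1\le i\le s$, where $s=\lfloor n/2\rfloor\ge 1$. Write the elements of ${\cal G}_n$ as matrices in the coordinates $(q_1,\dots,q_s,p_1,\dots,p_s)$ if $n=2s$, and in the coordinates $(q_1,\dots,q_s,p_1,\dots,p_s,x_{2s+1})$ if $n=2s+1$. (a) Let $n=2s$. Then ${\cal G}_{2s}\subset Sp(2s,\mathbb{Z})$, the symplectic group of the form $\sum_i(q_ip_i'-p_iq_i')$.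 The reduction of ${\cal G}_{2s}$ modulo 2 is isomorphic to the symmetric group $S_{2s+1}$ of $\{0,1,\dots,2s\}$, by an isomorphism taking the reduction of $\rho(\sigma_i)$ to the transposition $(i-1,i)$ for every $i$. Moreover ${\cal G}_{2s}$ contains the principal congruence subgroup of level 2, $\ker(Sp(2s,\mathbb{Z})\to Sp(2s,\mathbb{Z}/2\mathbb{Z}))$, and $$[Sp(2s,\mathbb{Z}):{\cal G}_{2s}]=\frac{2^{s^2}\prod_{k=1}^s(2^{2k}-1)}{(2s+1)!}.$$ (b) Let $n=2s+1$. Then ${\cal G}_{2s+1}\subset Sp(2s,\mathbb{Z})\ltimes\mathbb{Z}^{2s}$, realized as the group of block matrices $\begin{pmatrix}g_0&g_1\\0&1\end{pmatrix}$ with $g_0\in Sp(2s,\mathbb{Z})$ and $g_1\in\mathbb{Z}^{2s}$. The reduction of ${\cal G}_{2s+1}$ modulo 2 is isomorphic to the symmetric group $S_{2s+2}$ of $\{0,1,\dots,2s+1\}$, by an isomorphism taking the reduction of $\rho(\sigma_i)$ to the transposition $(i-1,i)$ for every $i$. Moreover ${\cal G}_{2s+1}$ contains the principal congruence subgroup of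 level 2, $\ker\bigl(Sp(2s,\mathbb{Z})\ltimes\mathbb{Z}^{2s}\to Sp(2s,\mathbb{Z}/2\mathbb{Z})\ltimes(\mathbb{Z}/2\mathbb{Z})^{2s}\bigr)$, and $$[Sp(2s,\mathbb{Z})\ltimes\mathbb{Z}^{2s}:{\cal G}_{2s+1}]=\frac{2^{s^2+2s}\prod_{k=1}^s(2^{2k}-1)}{(2s+2)!}.$$ -/

import Mathlib

open Matrix

namespace BraidSymplectic

/-! ### The braid group and its linear representation -/

/-- The defining relations of the braid group on `n + 1` strands, for generators
`σ_1, …, σ_n`; the generator `σ_{i+1}` is indexed by `i : Fin n`. -/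
inductive BraidRel (n : ℕ) : FreeGroup (Fin n) → Prop
  | braid (i j : Fin n) (h : (i : ℕ) + 1 = j) :
      BraidRel n (FreeGroup.of i * FreeGroup.of j * FreeGroup.of i *
        (FreeGroup.of j * FreeGroup.of i * FreeGroup.of j)⁻¹)
  | comm (i j : Fin n) (h : (i : ℕ) + 1 < j) :
      BraidRel n (FreeGroup.of i * FreeGroup.of j * (FreeGroup.of j * FreeGroup.of i)⁻¹)

/-- `BraidGroup n` is the Artin braid group `B_{n+1}` on `n + 1` strands. -/
abbrev BraidGroup (n : ℕ) : Type := PresentedGroup {r | BraidRel n r}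

/-- The action of the generator `σ_{i+1}` on the vector `(k_1, …, k_n)`, whose entry `k_{j+1}`
is `k j`:
`σ_1 : k_1 ↦ k_1, k_j ↦ k_j + k_1` for `j > 1`, and for `i > 1`
`σ_i : k_{i-1} ↦ 2 k_{i-1} - k_i, k_i ↦ k_{i-1}`, the other entries being fixed. -/
def sigmaFun {n : ℕ} (i : Fin n) (k : Fin n → ℤ) : Fin n → ℤ := fun j =>
  if (i : ℕ) = 0 then (if j = i then k i else k j + k i)
  else if j = i then k ⟨i - 1, by omega⟩
  else if (j : ℕ) + 1 = i then 2 * k j - k i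
  else k j

/-- The inverse of `sigmaFun i`. -/
def sigmaInvFun {n : ℕ} (i : Fin n) (k : Fin n → ℤ) : Fin n → ℤ := fun j =>
  if (i : ℕ) = 0 then (if j = i then k i else k j - k i)
  else if j = i then 2 * k i - k ⟨i - 1, by omega⟩
  else if (j : ℕ) + 1 = i then k i
  else k j

/-- The linear automorphism of `ℤ^n` by which `σ_{i+1}` acts. -/
def sigma {n : ℕ} (i : Fin n) : (Fin n → ℤ) ≃ₗ[ℤ] (Fin n → ℤ) where
  toFun := sigmaFun i
  invFun := sigmaInvFun i
  map_add' k l := by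
    funext j
    simp only [sigmaFun, Pi.add_apply]
    split_ifs <;> ring
  map_smul' c k := by
    funext j
    simp only [sigmaFun, Pi.smul_apply, smul_eq_mul, RingHom.id_apply]
    split_ifs <;> ring
  left_inv k := by
    funext j
    simp only [sigmaFun, sigmaInvFun]
    grind
  right_inv k := by
    funext j
    simp only [sigmaFun, sigmaInvFun]
    grind

theorem sigma_apply {n : ℕ} (i : Fin n) (k : Fin n → ℤ) (j : Fin n) :
    sigma i k j = sigmaFun i k j := rfl

theorem sigma_braid {n : ℕ} (i j : Fin n) (h : (i : ℕ) + 1 = j) :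
    sigma i * sigma j * sigma i = sigma j * sigma i * sigma j := by
  apply LinearEquiv.ext
  intro k
  funext l
  simp only [LinearEquiv.mul_apply, sigma_apply]
  simp only [sigmaFun, sigma_apply]
  grind

theorem sigma_comm {n : ℕ} (i j : Fin n) (h : (i : ℕ) + 1 < j) :
    sigma i * sigma j = sigma j * sigma i := by
  apply LinearEquiv.ext
  intro k
  funext l
  simp only [LinearEquiv.mul_apply, sigma_apply]
  simp only [sigmaFun, sigma_apply]
  grind

/-- The representation `ρ : B_{n+1} → GL(ℤ^n)`. -/
def rho (n : ℕ) : BraidGroup n →* ((Fin n → ℤ) ≃ₗ[ℤ] (Fin n → ℤ)) :=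
  PresentedGroup.toGroup (f := sigma) (by
    rintro r (⟨i, j, h⟩ | ⟨i, j, h⟩)
    · simp only [map_mul, map_inv, FreeGroup.lift_apply_of]
      exact mul_inv_eq_one.mpr (sigma_braid i j h)
    · simp only [map_mul, map_inv, FreeGroup.lift_apply_of]
      exact mul_inv_eq_one.mpr (sigma_comm i j h))

/-- The matrices of the representation `ρ` (acting on column vectors) in the linear coordinates
`c` on `ℤ^n`. -/
def rhoMatrix {n : ℕ} {ι : Type} [Fintype ι] [DecidableEq ι]
    (c : (Fin n → ℤ) ≃ₗ[ℤ] (ι → ℤ)) : BraidGroup n →* GL ι ℤ :=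
  ((Matrix.GeneralLinearGroup.toLin (n := ι) (R := ℤ)).symm.toMonoidHom.comp
    (LinearMap.GeneralLinearGroup.congrLinearEquiv c).toMonoidHom).comp
    ((LinearMap.GeneralLinearGroup.generalLinearEquiv ℤ (Fin n → ℤ)).symm.toMonoidHom.comp
      (rho n))

/-! ### The coordinates `x`, and the canonical coordinates `q`, `p` -/

/-- A finite vector, extended by zero. -/
def ext0 {n : ℕ} (k : Fin n → ℤ) (j : ℕ) : ℤ := if h : j < n then k ⟨j, h⟩ else 0

theorem ext0_add {n : ℕ} (k l : Fin n → ℤ) (j : ℕ) :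
    ext0 (k + l) j = ext0 k j + ext0 l j := by
  unfold ext0; split_ifs <;> simp

theorem ext0_smul {n : ℕ} (c : ℤ) (k : Fin n → ℤ) (j : ℕ) :
    ext0 (c • k) j = c * ext0 k j := by
  unfold ext0; split_ifs <;> simp

theorem ext0_val {n : ℕ} (k : Fin n → ℤ) (j : Fin n) : ext0 k j = k j := by
  simp [ext0]

/-- The alternating sum `f_i - f_{i-1} + ⋯ ± f_0`. -/
def altSum (f : ℕ → ℤ) (i : ℕ) : ℤ := ∑ j ∈ Finset.range (i + 1), (-1) ^ (i - j) * f j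

theorem altSum_zero (f : ℕ → ℤ) : altSum f 0 = f 0 := by simp [altSum]

theorem altSum_succ (f : ℕ → ℤ) (i : ℕ) : altSum f (i + 1) = f (i + 1) - altSum f i := by
  unfold altSum
  rw [Finset.sum_range_succ, sub_eq_add_neg, ← Finset.sum_neg_distrib, add_comm]
  congr 1
  · simp
  · refine Finset.sum_congr rfl fun j hj => ?_
    have : i + 1 - j = (i - j) + 1 := by have := Finset.mem_range.mp hj; omega
    rw [this, pow_succ]; ring

/-- The coordinates `x_i = k_i - k_{i-1} + ⋯ + (-1)^{i+1} k_1`, with inverse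
`k_i = x_{i-1} + x_i` (and `x_0 = 0`). -/
def xCoords (n : ℕ) : (Fin n → ℤ) ≃ₗ[ℤ] (Fin n → ℤ) where
  toFun k := fun i => altSum (ext0 k) i
  invFun x := fun i => (if (i : ℕ) = 0 then 0 else ext0 x (i - 1)) + x i
  map_add' k l := by
    funext i
    simp only [altSum, ext0_add, Pi.add_apply, ← Finset.sum_add_distrib, mul_add]
  map_smul' c k := by
    funext i
    simp only [altSum, ext0_smul, Pi.smul_apply, smul_eq_mul, RingHom.id_apply, Finset.mul_sum]
    exact Finset.sum_congr rfl fun j _ => by ring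
  left_inv k := by
    funext ⟨i, hi⟩
    rcases i with _ | i
    · simp [altSum_zero, ext0, hi]
    · have h : i < n := by omega
      simp [altSum_succ, ext0, hi, h]
  right_inv x := by
    funext ⟨i, hi⟩
    induction i with
    | zero => simp [altSum_zero, ext0, hi]
    | succ i ih =>
      have h : i < n := by omega
      have := ih h
      simp only at this
      simp only [altSum_succ, this]
      simp [ext0, hi, h]

theorem sum_Ico_sub' (X : ℕ → ℤ) (i s : ℕ) (h : i ≤ s) :
    ∑ j ∈ Finset.Ico i s, (X (2 * j) - X (2 * j + 2)) = X (2 * i) - X (2 * s) := by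
  induction s, h using Nat.le_induction with
  | base => simp
  | succ s hs ih => rw [Finset.sum_Ico_succ_top hs, ih, Nat.mul_succ]; ring

/-- For `n = 2s`: the coordinates `q_i = x_{2i-1} - x_{2i+1}` (where `x_{2s+1} = 0`) and
`p_i = x_{2i}`, `1 ≤ i ≤ s`, with inverse `x_{2i-1} = ∑_{j ≥ i} q_j`, `x_{2i} = p_i`.
The coordinates `q` come first, then the coordinates `p`. -/
def qpEven (s : ℕ) : (Fin (2 * s) → ℤ) ≃ₗ[ℤ] (Fin s ⊕ Fin s → ℤ) where
  toFun x := Sum.elim (fun i => ext0 x (2 * i) - ext0 x (2 * i + 2))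
    (fun i => ext0 x (2 * i + 1))
  invFun v := fun a =>
    if (a : ℕ) % 2 = 0 then ∑ j ∈ Finset.Ico ((a : ℕ) / 2) s, ext0 (fun i => v (Sum.inl i)) j
    else ext0 (fun i => v (Sum.inr i)) ((a : ℕ) / 2)
  map_add' x y := by
    funext i
    rcases i with i | i <;> simp only [Sum.elim_inl, Sum.elim_inr, Pi.add_apply, ext0_add]
    ring
  map_smul' c x := by
    funext i
    rcases i with i | i <;>
      simp only [Sum.elim_inl, Sum.elim_inr, Pi.smul_apply, ext0_smul, smul_eq_mul,
        RingHom.id_apply]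
    ring
  left_inv x := by
    funext ⟨a, ha⟩
    simp only [Sum.elim_inl, Sum.elim_inr]
    split_ifs with h
    · rw [Finset.sum_congr rfl (g := fun j => ext0 x (2 * j) - ext0 x (2 * j + 2)),
        sum_Ico_sub' _ _ _ (by omega)]
      · have h2 : 2 * (a / 2) = a := by omega
        simp [ext0, h2, ha]
      · intro j hj
        simp [ext0, (Finset.mem_Ico.mp hj).2]
    · have h2 : 2 * (a / 2) + 1 = a := by omega
      have h3 : a / 2 < s := by omega
      simp [ext0, h2, h3, ha]
  right_inv v := by
    funext i
    rcases i with ⟨i, hi⟩ | ⟨i, hi⟩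
    · simp only [Sum.elim_inl]
      rcases Nat.lt_or_ge (i + 1) s with h | h
      · have h1 : 2 * i < 2 * s := by omega
        have h2 : 2 * i + 2 < 2 * s := by omega
        have h3 : (2 * i + 2) / 2 = i + 1 := by omega
        simp [ext0, h1, h2, h3, Finset.sum_eq_sum_Ico_succ_bot hi, hi]
      · have h1 : 2 * i < 2 * s := by omega
        have h2 : ¬ 2 * i + 2 < 2 * s := by omega
        have h3 : Finset.Ico (i + 1) s = ∅ := Finset.Ico_eq_empty (by omega)
        simp [ext0, h1, h2, Finset.sum_eq_sum_Ico_succ_bot hi, hi, h3]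
    · have h1 : 2 * i + 1 < 2 * s := by omega
      have h2 : (2 * i + 1) / 2 = i := by omega
      have h3 : (2 * i + 1) % 2 ≠ 0 := by omega
      simp [ext0, h1, h2, h3, hi]

/-- For `n = 2s + 1`: the coordinates `q_i = x_{2i-1} - x_{2i+1}` and `p_i = x_{2i}`,
`1 ≤ i ≤ s`, followed by the last coordinate `x_{2s+1}`. -/
def qpOdd (s : ℕ) : (Fin (2 * s + 1) → ℤ) ≃ₗ[ℤ] ((Fin s ⊕ Fin s) ⊕ Unit → ℤ) where
  toFun x := Sum.elim (Sum.elim (fun i => ext0 x (2 * i) - ext0 x (2 * i + 2))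
    (fun i => ext0 x (2 * i + 1))) (fun _ => ext0 x (2 * s))
  invFun v := fun a =>
    if (a : ℕ) % 2 = 0 then
      ∑ j ∈ Finset.Ico ((a : ℕ) / 2) s, ext0 (fun i => v (Sum.inl (Sum.inl i))) j
        + v (Sum.inr ())
    else ext0 (fun i => v (Sum.inl (Sum.inr i))) ((a : ℕ) / 2)
  map_add' x y := by
    funext i
    rcases i with (i | i) | i <;> simp only [Sum.elim_inl, Sum.elim_inr, Pi.add_apply, ext0_add]
    ring
  map_smul' c x := by
    funext i
    rcases i with (i | i) | i <;>
      simp only [Sum.elim_inl, Sum.elim_inr, Pi.smul_apply, ext0_smul, smul_eq_mul,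
        RingHom.id_apply]
    ring
  left_inv x := by
    funext ⟨a, ha⟩
    simp only [Sum.elim_inl, Sum.elim_inr]
    split_ifs with h
    · rw [Finset.sum_congr rfl (g := fun j => ext0 x (2 * j) - ext0 x (2 * j + 2)),
        sum_Ico_sub' _ _ _ (by omega)]
      · have h2 : 2 * (a / 2) = a := by omega
        simp [ext0, h2, ha]
      · intro j hj
        simp [ext0, (Finset.mem_Ico.mp hj).2]
    · have h2 : 2 * (a / 2) + 1 = a := by omega
      have h3 : a / 2 < s := by omega
      simp [ext0, h2, h3, ha]
  right_inv v := by
    funext i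
    rcases i with (⟨i, hi⟩ | ⟨i, hi⟩) | i
    · simp only [Sum.elim_inl]
      have h1 : 2 * i < 2 * s + 1 := by omega
      have h2 : 2 * i + 2 < 2 * s + 1 := by omega
      have h3 : (2 * i + 2) / 2 = i + 1 := by omega
      simp [ext0, h1, h2, h3, Finset.sum_eq_sum_Ico_succ_bot hi, hi]
    · have h1 : 2 * i + 1 < 2 * s + 1 := by omega
      have h2 : (2 * i + 1) / 2 = i := by omega
      have h3 : (2 * i + 1) % 2 ≠ 0 := by omega
      simp [ext0, h1, h2, h3, hi]
    · simp [ext0]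

/-- `ρ` on `B_{2s+1}` as integer matrices in the canonical coordinates `q_1, …, q_s, p_1, …, p_s`. -/
def rhoEven (s : ℕ) : BraidGroup (2 * s) →* GL (Fin s ⊕ Fin s) ℤ :=
  rhoMatrix ((xCoords (2 * s)).trans (qpEven s))

/-- `ρ` on `B_{2s+2}` as integer matrices in the coordinates
`q_1, …, q_s, p_1, …, p_s, x_{2s+1}`. -/
def rhoOdd (s : ℕ) : BraidGroup (2 * s + 1) →* GL ((Fin s ⊕ Fin s) ⊕ Unit) ℤ :=
  rhoMatrix ((xCoords (2 * s + 1)).trans (qpOdd s))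

/-! ### The ambient groups and reduction modulo 2 -/

/-- The symplectic group `Sp(2s, ℤ)`, as a group of invertible matrices. -/
def Sp (s : ℕ) : Subgroup (GL (Fin s ⊕ Fin s) ℤ) where
  carrier := {g | (g : Matrix (Fin s ⊕ Fin s) (Fin s ⊕ Fin s) ℤ) ∈ symplecticGroup (Fin s) ℤ}
  mul_mem' {a b} ha hb := by
    simpa using mul_mem ha hb
  one_mem' := by simp
  inv_mem' {a} ha := by
    have h : ((⟨_, ha⟩ : symplecticGroup (Fin s) ℤ)⁻¹ : symplecticGroup (Fin s) ℤ).1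
        = (a : Matrix (Fin s ⊕ Fin s) (Fin s ⊕ Fin s) ℤ)⁻¹ := SymplecticGroup.coe_inv' _
    simp only [Set.mem_ofPred_eq, Matrix.coe_units_inv, ← h]
    exact Subtype.prop _

/-- The semidirect product `Sp(2s, ℤ) ⋉ ℤ^{2s}`: the block matrices `(g₀ g₁; 0 1)` with
`g₀ ∈ Sp(2s, ℤ)` and an arbitrary column `g₁ ∈ ℤ^{2s}`. -/
def SpAffine (s : ℕ) : Subgroup (GL ((Fin s ⊕ Fin s) ⊕ Unit) ℤ) where
  carrier := {g | ∃ g₀ ∈ Sp s, ∃ g₁ : Fin s ⊕ Fin s → ℤ,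
    (g : Matrix ((Fin s ⊕ Fin s) ⊕ Unit) ((Fin s ⊕ Fin s) ⊕ Unit) ℤ) =
      fromBlocks (g₀ : Matrix (Fin s ⊕ Fin s) (Fin s ⊕ Fin s) ℤ) (replicateCol Unit g₁) 0 1}
  mul_mem' := by
    rintro a b ⟨a₀, ha, a₁, ea⟩ ⟨b₀, hb, b₁, eb⟩
    refine ⟨a₀ * b₀, mul_mem ha hb,
      (a₀ : Matrix (Fin s ⊕ Fin s) (Fin s ⊕ Fin s) ℤ) *ᵥ b₁ + a₁, ?_⟩
    rw [Units.val_mul, ea, eb, fromBlocks_multiply]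
    simp [replicateCol_add, replicateCol_mulVec]
  one_mem' := ⟨1, one_mem _, 0, by simp [fromBlocks_one]⟩
  inv_mem' := by
    rintro a ⟨a₀, ha, a₁, ea⟩
    refine ⟨a₀⁻¹, inv_mem ha,
      -(((a₀⁻¹ : GL (Fin s ⊕ Fin s) ℤ) : Matrix (Fin s ⊕ Fin s) (Fin s ⊕ Fin s) ℤ) *ᵥ a₁), ?_⟩
    refine Units.inv_eq_of_mul_eq_one_right ?_
    rw [ea, fromBlocks_multiply, ← fromBlocks_one]
    have h : (a₀ : Matrix (Fin s ⊕ Fin s) (Fin s ⊕ Fin s) ℤ) *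
        ((a₀⁻¹ : GL (Fin s ⊕ Fin s) ℤ) : Matrix (Fin s ⊕ Fin s) (Fin s ⊕ Fin s) ℤ) = 1 :=
      Units.mul_inv a₀
    have h2 : replicateCol Unit (-(((a₀⁻¹ : GL (Fin s ⊕ Fin s) ℤ) :
          Matrix (Fin s ⊕ Fin s) (Fin s ⊕ Fin s) ℤ) *ᵥ a₁))
        = -(((a₀⁻¹ : GL (Fin s ⊕ Fin s) ℤ) :
          Matrix (Fin s ⊕ Fin s) (Fin s ⊕ Fin s) ℤ) * replicateCol Unit a₁) := by
      rw [← replicateCol_mulVec]; rfl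
    rw [h2, Matrix.mul_neg, ← Matrix.mul_assoc, h]
    simp

/-- Entrywise reduction modulo 2 of invertible integer matrices. -/
def mod2 (ι : Type) [Fintype ι] [DecidableEq ι] : GL ι ℤ →* GL ι (ZMod 2) :=
  Matrix.GeneralLinearGroup.map (Int.castRingHom (ZMod 2))

/-- The principal congruence subgroup of level 2 of a group of integer matrices: the kernel of
the reduction modulo 2 on this group. -/
def principalCongruence {ι : Type} [Fintype ι] [DecidableEq ι] (H : Subgroup (GL ι ℤ)) :
    Subgroup (GL ι ℤ) :=
  H ⊓ (mod2 ι).ker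

end BraidSymplectic

/-
In the coordinates `q`, `p` the generators of the braid group act as the transvections
`x ↦ x + ω(x, a_i) a_i` along a chain of vectors `a_0, a_1, …`, in which consecutive vectors pair to
`1` and all others are orthogonal. In odd dimension the first generator is moreover composed with
the translation by `-a_0`.

Modulo 2 a vector `k` records the differences of a labelling of the strands by residues, and the
braids permute the strands; this identifies the reduction with a symmetric group.

For the principal congruence subgroup, write `H` for a group containing the transvections along a
chain of length `2s` which spans. It contains the squares of the transvections along all sums of
consecutive members of the chain, hence enough transformations to move any isometry congruent to the
identity modulo 2 back to the identity, one hyperbolic pair at a time, by a Euclidean algorithm on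
the coordinates. The translations by `2 a_i` are obtained from the square of the first generator.

The index is therefore an index in the reduction modulo 2. The isometries of the reduction act
transitively on hyperbolic pairs, because the transvections do, which gives the order
`∏ (2^(2k) - 1) 2^(2k-1)` of the symplectic group over the field with two elements.
-/

namespace BraidSymplectic

section Transvection

variable {R M : Type*} [CommRing R] [AddCommGroup M] [Module R M]

/-- The transvection `x ↦ x + c ω(x, v) v` of an alternating form `ω`, a linear automorphism. -/
def transv (ω : LinearMap.BilinForm R M) (hω : ω.IsAlt) (v : M) (c : R) : M ≃ₗ[R] M :=
  LinearEquiv.transvection (f := c • ω.flip v) (v := v) (by simp [hω v])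

/-- The group of linear isometries of a bilinear form. -/
def isometries (ω : LinearMap.BilinForm R M) : Subgroup (M ≃ₗ[R] M) where
  carrier := {g | ∀ x y, ω (g x) (g y) = ω x y}
  mul_mem' {g h} hg hh x y := by rw [LinearEquiv.mul_apply, LinearEquiv.mul_apply, hg, hh]
  one_mem' _ _ := rfl
  inv_mem' {g} hg x y := by
    rw [← hg (g⁻¹ x) (g⁻¹ y)]
    simp

variable {ω : LinearMap.BilinForm R M}

theorem mem_isometries {g : M ≃ₗ[R] M} : g ∈ isometries ω ↔ ∀ x y, ω (g x) (g y) = ω x y :=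
  Iff.rfl

variable (hω : ω.IsAlt)

include hω in
theorem apply_swap_eq_neg (x y : M) : ω y x = -ω x y :=
  (LinearMap.IsAlt.neg hω x y).symm

theorem transv_apply (v : M) (c : R) (x : M) : transv ω hω v c x = x + (c * ω x v) • v := rfl

theorem transv_zero (v : M) : transv ω hω v 0 = 1 := by
  ext x
  simp [transv_apply]

theorem transv_mul (v : M) (c d : R) :
    transv ω hω v c * transv ω hω v d = transv ω hω v (c + d) := by
  ext x
  simp only [LinearEquiv.mul_apply, transv_apply, map_add, map_smul, hω v]
  module

theorem transv_inv (v : M) (c : R) : (transv ω hω v c)⁻¹ = transv ω hω v (-c) := by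
  rw [inv_eq_iff_mul_eq_one, transv_mul, add_neg_cancel, transv_zero]

theorem transv_apply_of_eq_zero {v x : M} (h : ω x v = 0) (c : R) : transv ω hω v c x = x := by
  rw [transv_apply, h, mul_zero, zero_smul, add_zero]

theorem transv_mem_isometries (v : M) (c : R) : transv ω hω v c ∈ isometries ω := by
  intro x y
  simp only [transv_apply, map_add, map_smul, LinearMap.add_apply, LinearMap.smul_apply, hω v,
    smul_eq_mul, apply_swap_eq_neg hω y v]
  ring

theorem transv_conj {g : M ≃ₗ[R] M} (hg : g ∈ isometries ω) (v : M) (c : R) :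
    g * transv ω hω v c * g⁻¹ = transv ω hω (g v) c := by
  rw [mul_inv_eq_iff_eq_mul]
  ext x
  simp [LinearEquiv.mul_apply, transv_apply, hg x v]

variable {H : Subgroup (M ≃ₗ[R] M)}

theorem transv_intCast_mul_mem {v : M} {c : R} (hv : transv ω hω v c ∈ H) (k : ℤ) :
    transv ω hω v (k * c) ∈ H := by
  let φ : Multiplicative R →* (M ≃ₗ[R] M) :=
    ⟨⟨fun d => transv ω hω v d.toAdd, transv_zero hω v⟩, fun d d' => (transv_mul hω v _ _).symm⟩
  have hφ : φ (Multiplicative.ofAdd c ^ k) = transv ω hω v (k * c) := by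
    rw [← zsmul_eq_mul, ← ofAdd_zsmul]
    rfl
  rw [← hφ, map_zpow]
  exact zpow_mem hv k

theorem transv_two_mem {v : M} (hv : transv ω hω v 1 ∈ H) : transv ω hω v 2 ∈ H := by
  simpa using transv_intCast_mul_mem hω hv 2

theorem transv_add_mem {v r : M} {c : R} (hv : transv ω hω v c ∈ H)
    (hr : transv ω hω r 1 ∈ H) (h : ω v r = 1) : transv ω hω (v + r) c ∈ H := by
  have hvr : transv ω hω r 1 v = v + r := by rw [transv_apply, h, mul_one, one_smul]
  rw [← hvr, ← transv_conj hω (transv_mem_isometries hω r 1)]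
  exact mul_mem (mul_mem hr hv) (inv_mem hr)

/-- In the braid group on four strands this is the decomposition of the full twist. -/
theorem transv_two_add_eq_mul {x y z : M} (hxy : ω x y = 1) (hyz : ω y z = 1) (hxz : ω x z = 0) :
    transv ω hω (x + z) 2 =
      transv ω hω x 2 * transv ω hω (x + y) 2 * transv ω hω y 2 * transv ω hω (x + y + z) 2 *
        transv ω hω (y + z) 2 * transv ω hω z 2 := by
  have hyx : ω y x = -1 := by rw [apply_swap_eq_neg hω x y, hxy]
  have hzy : ω z y = -1 := by rw [apply_swap_eq_neg hω y z, hyz]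
  have hzx : ω z x = 0 := by rw [apply_swap_eq_neg hω x z, hxz, neg_zero]
  ext v
  simp only [LinearEquiv.mul_apply, transv_apply, map_add, map_smul, hω x, hω y, hω z,
    hxy, hyz, hyx, hzy, hzx]
  module

theorem transv_two_add_mem {x y z : M} (hxy : ω x y = 1) (hyz : ω y z = 1) (hxz : ω x z = 0)
    (hx : transv ω hω x 2 ∈ H) (hy : transv ω hω y 1 ∈ H) (hz : transv ω hω z 1 ∈ H) :
    transv ω hω (x + z) 2 ∈ H := by
  have hxy_mem := transv_add_mem hω hx hy hxy
  have hxyz_mem := transv_add_mem hω hxy_mem hz (by simp [hxz, hyz])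
  have hyz_mem := transv_add_mem hω (transv_two_mem hω hy) hz hyz
  rw [transv_two_add_eq_mul hω hxy hyz hxz]
  exact mul_mem (mul_mem (mul_mem (mul_mem (mul_mem hx hxy_mem) (transv_two_mem hω hy)) hxyz_mem)
    hyz_mem) (transv_two_mem hω hz)

end Transvection

section Eichler

variable {R M : Type*} [CommRing R] [AddCommGroup M] [Module R M] {ω : LinearMap.BilinForm R M}

/-- The Eichler transformation `x ↦ x + ω(x, b) y + ω(x, y) b`. It is used only for `y` orthogonal
to `b`, where it is an isometry of the alternating form `ω` which fixes `b`. -/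
def eichler (ω : LinearMap.BilinForm R M) (b y : M) : M →ₗ[R] M :=
  LinearMap.id + (ω.flip b).smulRight y + (ω.flip y).smulRight b

theorem eichler_apply (b y x : M) : eichler ω b y x = x + ω x b • y + ω x y • b := rfl

theorem eichler_zero (b : M) : eichler ω b 0 = LinearMap.id := by
  ext x
  simp [eichler_apply]

variable (hω : ω.IsAlt)

theorem eichler_two_smul_eq_of_add {b u : M} (hub : ω u b = 0) :
    eichler ω b ((2 : R) • u) =
      ↑(transv ω hω (b + u) 2 * (transv ω hω b 2 * transv ω hω u 2)⁻¹) := by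
  have hbu : ω b u = 0 := by rw [apply_swap_eq_neg hω u b, hub, neg_zero]
  ext x
  simp only [LinearEquiv.coe_coe, _root_.mul_inv_rev, transv_inv, LinearEquiv.mul_apply,
    transv_apply, eichler_apply, map_add, map_smul, hω b, hω u, hub, hbu,
    smul_eq_mul]
  module

theorem eichler_two_smul_eq_of_sub {b u : M} (hub : ω u b = 0) :
    eichler ω b ((2 : R) • u) =
      ↑((transv ω hω (u - b) 2)⁻¹ * (transv ω hω b 2 * transv ω hω u 2)) := by
  have hbu : ω b u = 0 := by rw [apply_swap_eq_neg hω u b, hub, neg_zero]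
  ext x
  simp only [LinearEquiv.coe_coe, transv_inv, LinearEquiv.mul_apply, transv_apply, eichler_apply,
    map_add, map_sub, map_smul, hω b, hω u, hub, hbu]
  module

theorem eichler_add {b y z : M} (hyb : ω y b = 0) (hzb : ω z b = 0) :
    eichler ω b (y + z) = ↑(transv ω hω b (-ω z y)) ∘ₗ eichler ω b y ∘ₗ eichler ω b z := by
  have hby : ω b y = 0 := by rw [apply_swap_eq_neg hω y b, hyb, neg_zero]
  ext x
  simp only [LinearMap.comp_apply, LinearEquiv.coe_coe, transv_apply, eichler_apply, map_add,
    map_smul, hω b, hyb, hzb, hby]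
  module

end Eichler

section Chain

variable {R M : Type*} [CommRing R] [AddCommGroup M] [Module R M] {ω : LinearMap.BilinForm R M}

/-- A chain of `N` vectors: consecutive ones pair to `1`, all others are orthogonal. -/
structure IsFormChain (ω : LinearMap.BilinForm R M) (a : ℕ → M) (N : ℕ) : Prop where
  isAlt : ω.IsAlt
  adj : ∀ i, i + 1 < N → ω (a i) (a (i + 1)) = 1
  orth : ∀ i j, i + 1 < j → j < N → ω (a i) (a j) = 0

/-- The sum of the `l + 1` consecutive members of a sequence from the `i`-th on. For a chain these
are the roots of the corresponding root system of type A. -/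
def chainSeg (a : ℕ → M) (i l : ℕ) : M := ∑ k ∈ Finset.range (l + 1), a (i + k)

/-- The sum of the first `m + 1` members of even index of a sequence. For a chain it is the vector
dual to `chainF a m` in a hyperbolic basis. -/
def chainE (a : ℕ → M) (m : ℕ) : M := ∑ k ∈ Finset.range (m + 1), a (2 * k)

/-- The members of odd index of a sequence. For a chain they span an isotropic subspace. -/
def chainF (a : ℕ → M) (m : ℕ) : M := a (2 * m + 1)

theorem chainE_succ (a : ℕ → M) (m : ℕ) : chainE a (m + 1) = chainE a m + a (2 * m + 2) :=
  Finset.sum_range_succ _ _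

theorem chainSeg_succ (a : ℕ → M) (i l : ℕ) :
    chainSeg a i (l + 1) = chainSeg a i l + a (i + l + 1) :=
  Finset.sum_range_succ _ _

theorem apply_chainSeg {x : M} {i l : ℕ} (hx : ∀ k, i < k → k ≤ i + l → ω x (a k) = 0) :
    ω x (chainSeg a i l) = ω x (a i) := by
  induction l with
  | zero => simp [chainSeg]
  | succ l ih =>
    rw [chainSeg_succ, map_add, ih fun k h1 h2 => hx k h1 (by omega),
      hx (i + l + 1) (by omega) (by omega), add_zero]

namespace IsFormChain

variable {a : ℕ → M} {N : ℕ} (hc : IsFormChain ω a N)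
include hc

theorem mono {L : ℕ} (hL : L ≤ N) : IsFormChain ω a L where
  isAlt := hc.isAlt
  adj i hi := hc.adj i (hi.trans_le hL)
  orth i j hij hj := hc.orth i j hij (hj.trans_le hL)

omit hc in
theorem shift (hc : IsFormChain ω a (N + 1)) : IsFormChain ω (fun i => a (i + 1)) N where
  isAlt := hc.isAlt
  adj i hi := hc.adj (i + 1) (by omega)
  orth i j hij hj := hc.orth (i + 1) (j + 1) (by omega) (by omega)

theorem apply_eq {i j : ℕ} (hi : i < N) (hj : j < N) :
    ω (a i) (a j) = if i + 1 = j then 1 else if j + 1 = i then -1 else 0 := by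
  split_ifs with hij hji
  · subst hij
    exact hc.adj i hj
  · subst hji
    rw [apply_swap_eq_neg hc.isAlt (a j), hc.adj j hi]
  · rcases lt_trichotomy i j with hlt | rfl | hgt
    · exact hc.orth i j (by omega) hj
    · exact hc.isAlt (a i)
    · rw [apply_swap_eq_neg hc.isAlt (a j), hc.orth j i (by omega) hi, neg_zero]

theorem chainE_apply {m j : ℕ} (hm : 2 * m < N) (hj : j < N) :
    ω (chainE a m) (a j) = if j = 2 * m + 1 then 1 else 0 := by
  induction m with
  | zero =>
    rw [chainE, zero_add, Finset.sum_range_one, hc.apply_eq hm hj]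
    grind
  | succ m ih =>
    rw [chainE_succ, map_add, LinearMap.add_apply, ih (by omega), hc.apply_eq (by omega) hj]
    grind

theorem chainE_chainF {i j : ℕ} (hi : 2 * i < N) (hj : 2 * j + 1 < N) :
    ω (chainE a i) (chainF a j) = if i = j then 1 else 0 := by
  rw [chainF, hc.chainE_apply hi hj]
  grind

theorem chainE_chainE {i j : ℕ} (hi : 2 * i < N) (hj : 2 * j < N) :
    ω (chainE a i) (chainE a j) = 0 := by
  rw [chainE.eq_1 a j, map_sum]
  refine Finset.sum_eq_zero fun k hk => ?_
  have := Finset.mem_range.mp hk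
  rw [hc.chainE_apply hi (by omega), if_neg (by omega)]

theorem chainF_chainF {i j : ℕ} (hi : 2 * i + 1 < N) (hj : 2 * j + 1 < N) :
    ω (chainF a i) (chainF a j) = 0 := by
  rw [chainF, chainF, hc.apply_eq hi hj]
  grind

theorem chainE_add_chainF_apply {i j k : ℕ} (hij : i ≤ j) (hjk : 2 * j < k) (hk : k < N) :
    ω (chainE a j + chainF a i) (a k) =
      if k = 2 * j + 1 then 1 else if i = j ∧ k = 2 * j + 2 then 1 else 0 := by
  rw [map_add, LinearMap.add_apply, hc.chainE_apply (by omega) hk, chainF,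
    hc.apply_eq (by omega) hk]
  grind

theorem chainSeg_apply {i l j : ℕ} (hij : i + l < j) (hj : j < N) :
    ω (chainSeg a i l) (a j) = if j = i + l + 1 then 1 else 0 := by
  induction l with
  | zero =>
    simp only [chainSeg, zero_add, Finset.sum_range_one, add_zero,
      hc.apply_eq (show i < N by omega) hj]
    grind
  | succ l ih =>
    rw [chainSeg_succ, map_add, LinearMap.add_apply, ih (by omega), hc.apply_eq (by omega) hj]
    grind

variable {H : Subgroup (M ≃ₗ[R] M)} (hH : ∀ i < N, transv ω hc.isAlt (a i) 1 ∈ H)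
include hH

theorem transv_chainSeg_mem {i l : ℕ} (h : i + l < N) :
    transv ω hc.isAlt (chainSeg a i l) 1 ∈ H := by
  induction l with
  | zero => simpa [chainSeg] using hH i h
  | succ l ih =>
    rw [chainSeg_succ]
    refine transv_add_mem _ (ih (by omega)) (hH _ h) ?_
    rw [hc.chainSeg_apply (by omega) (by omega), if_pos rfl]

theorem transv_chainE_mem {i : ℕ} (hi : 2 * i < N) :
    transv ω hc.isAlt (chainE a i) 2 ∈ H := by
  induction i with
  | zero => simpa [chainE] using transv_two_mem _ (hH 0 hi)
  | succ i ih =>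
    rw [chainE_succ]
    refine transv_two_add_mem _ (y := a (2 * i + 1)) ?_ ?_ ?_ (ih (by omega)) (hH _ (by omega))
      (hH _ hi)
    · rw [hc.chainE_apply (by omega) (by omega), if_pos rfl]
    · exact hc.adj _ hi
    · rw [hc.chainE_apply (by omega) (by omega), if_neg (by omega)]

theorem transv_chainF_mem {i : ℕ} (hi : 2 * i + 1 < N) :
    transv ω hc.isAlt (chainF a i) 2 ∈ H :=
  transv_two_mem _ (hH _ hi)

theorem transv_chainE_sub_mem {i j : ℕ} (hij : i < j) (hj : 2 * j < N) :
    transv ω hc.isAlt (chainE a j - chainE a i) 2 ∈ H := by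
  induction j, hij using Nat.le_induction with
  | base =>
    rw [Nat.succ_eq_add_one, chainE_succ, add_sub_cancel_left]
    exact transv_two_mem _ (hH _ hj)
  | succ j hij ih =>
    rw [chainE_succ, add_sub_right_comm]
    refine transv_two_add_mem _ (y := a (2 * j + 1)) ?_ ?_ ?_ (ih (by omega)) (hH _ (by omega))
      (hH _ hj)
    · rw [map_sub, LinearMap.sub_apply, hc.chainE_apply (by omega) (by omega),
        hc.chainE_apply (by omega) (by omega), if_pos rfl, if_neg (by omega), sub_zero]
    · exact hc.adj _ hj
    · rw [map_sub, LinearMap.sub_apply, hc.chainE_apply (by omega) (by omega),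
        hc.chainE_apply (by omega) (by omega), if_neg (by omega), if_neg (by omega), sub_zero]

theorem transv_add_chainF_mem {x : M} {i j : ℕ} (hij : i ≤ 2 * j) (hj : 2 * j + 1 < N)
    (hx : transv ω hc.isAlt x 2 ∈ H) (h1 : ω x (a i) = 1)
    (h0 : ∀ k, i < k → k ≤ 2 * j + 1 → ω x (a k) = 0) :
    transv ω hc.isAlt (x + chainF a j) 2 ∈ H := by
  refine transv_two_add_mem _ (y := chainSeg a i (2 * j - i)) ?_ ?_ (h0 _ (by omega) le_rfl) hx
    (hc.transv_chainSeg_mem hH (by omega)) (hH _ hj)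
  · rw [apply_chainSeg fun k h h' => h0 k h (by omega), h1]
  · rw [chainF, hc.chainSeg_apply (by omega) hj, if_pos (by omega)]

theorem transv_chainF_add_chainF_mem {i j : ℕ} (hij : i < j) (hj : 2 * j + 1 < N) :
    transv ω hc.isAlt (chainF a i + chainF a j) 2 ∈ H :=
  hc.transv_add_chainF_mem hH (i := 2 * i + 2) (by omega) hj
    (hc.transv_chainF_mem hH (by omega)) (hc.adj _ (by omega))
    fun k hk hk' => hc.orth _ _ (by omega) (by omega)

theorem transv_chainE_add_chainF_mem_of_lt {i j : ℕ} (hij : i < j) (hj : 2 * j + 1 < N) :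
    transv ω hc.isAlt (chainE a i + chainF a j) 2 ∈ H :=
  hc.transv_add_chainF_mem hH (i := 2 * i + 1) (by omega) hj
    (hc.transv_chainE_mem hH (by omega))
    (by rw [hc.chainE_apply (by omega) (by omega), if_pos rfl])
    fun k hk hk' => by rw [hc.chainE_apply (by omega) (by omega), if_neg (by omega)]

theorem transv_chainE_add_chainF_self_mem {i : ℕ} (hi : 2 * i + 1 < N) :
    transv ω hc.isAlt (chainE a i + chainF a i) 2 ∈ H :=
  transv_add_mem _ (hc.transv_chainE_mem hH (by omega)) (hH _ hi)
    (by rw [hc.chainE_chainF (by omega) hi, if_pos rfl])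

theorem transv_chainE_add_chainF_mem_of_gt {i j : ℕ} (hij : i < j) (hj : 2 * j < N) :
    transv ω hc.isAlt (chainE a j + chainF a i) 2 ∈ H := by
  induction j, hij using Nat.le_induction with
  | base =>
    rw [Nat.succ_eq_add_one, chainE_succ, add_right_comm]
    refine transv_add_mem _ (hc.transv_chainE_add_chainF_self_mem hH (by omega)) (hH _ hj) ?_
    rw [hc.chainE_add_chainF_apply le_rfl (by omega) (by omega), if_neg (by omega),
      if_pos ⟨rfl, rfl⟩]
  | succ j hij ih =>
    rw [chainE_succ, add_right_comm]
    refine transv_two_add_mem _ (y := a (2 * j + 1)) ?_ (hc.adj _ hj) ?_ (ih (by omega))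
      (hH _ (by omega)) (hH _ hj)
    · rw [hc.chainE_add_chainF_apply (by omega) (by omega) (by omega), if_pos rfl]
    · rw [hc.chainE_add_chainF_apply (by omega) (by omega) (by omega), if_neg (by omega),
        if_neg (by omega)]

theorem transv_chainE_add_chainF_mem {i j : ℕ} (hi : 2 * i + 1 < N) (hj : 2 * j + 1 < N) :
    transv ω hc.isAlt (chainE a i + chainF a j) 2 ∈ H := by
  rcases lt_trichotomy i j with hij | rfl | hji
  · exact hc.transv_chainE_add_chainF_mem_of_lt hH hij hj
  · exact hc.transv_chainE_add_chainF_self_mem hH hi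
  · exact hc.transv_chainE_add_chainF_mem_of_gt hH hji (by omega)

end IsFormChain

end Chain

section PairSet

variable {α : Type*} {e f : ℕ → α} {m s i : ℕ}

/-- The members `e i`, `f i` of two families with `m ≤ i < s`. -/
def pairSet (e f : ℕ → α) (m s : ℕ) : Set α := e '' Set.Ico m s ∪ f '' Set.Ico m s

theorem left_mem_pairSet (hm : m ≤ i) (hi : i < s) : e i ∈ pairSet e f m s :=
  Or.inl ⟨i, ⟨hm, hi⟩, rfl⟩

theorem right_mem_pairSet (hm : m ≤ i) (hi : i < s) : f i ∈ pairSet e f m s :=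
  Or.inr ⟨i, ⟨hm, hi⟩, rfl⟩

theorem pairSet_anti {n : ℕ} (h : m ≤ n) : pairSet e f n s ⊆ pairSet e f m s :=
  Set.union_subset_union (Set.image_mono (Set.Ico_subset_Ico_left h))
    (Set.image_mono (Set.Ico_subset_Ico_left h))

theorem eq_or_mem_pairSet_succ {u : α} (hu : u ∈ pairSet e f m s) :
    u = e m ∨ u = f m ∨ u ∈ pairSet e f (m + 1) s := by
  obtain ⟨j, ⟨hmj, hj⟩, rfl⟩ | ⟨j, ⟨hmj, hj⟩, rfl⟩ := hu <;> rcases hmj.eq_or_lt with rfl | hmj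
  · exact Or.inl rfl
  · exact Or.inr (Or.inr (left_mem_pairSet hmj hj))
  · exact Or.inr (Or.inl rfl)
  · exact Or.inr (Or.inr (right_mem_pairSet hmj hj))

end PairSet

section Hyperbolic

variable {R M : Type*} [CommRing R] [AddCommGroup M] [Module R M] {ω : LinearMap.BilinForm R M}

/-- Families `e`, `f` whose first `s` members are a hyperbolic system. -/
structure IsHyperbolic (ω : LinearMap.BilinForm R M) (e f : ℕ → M) (s : ℕ) : Prop where
  isAlt : ω.IsAlt
  ef : ∀ i < s, ∀ j < s, ω (e i) (f j) = if i = j then 1 else 0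
  ee : ∀ i < s, ∀ j < s, ω (e i) (e j) = 0
  ff : ∀ i < s, ∀ j < s, ω (f i) (f j) = 0

variable (R) in
/-- The span of the members `e i`, `f i` of two families with `m ≤ i < s`. -/
def pairSpan (e f : ℕ → M) (m s : ℕ) : Submodule R M := Submodule.span R (pairSet e f m s)

variable {e f : ℕ → M} {m s i : ℕ}

theorem left_mem_pairSpan (hm : m ≤ i) (hi : i < s) : e i ∈ pairSpan R e f m s :=
  Submodule.subset_span (left_mem_pairSet hm hi)

theorem right_mem_pairSpan (hm : m ≤ i) (hi : i < s) : f i ∈ pairSpan R e f m s :=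
  Submodule.subset_span (right_mem_pairSet hm hi)

theorem pairSpan_anti {n : ℕ} (h : m ≤ n) : pairSpan R e f n s ≤ pairSpan R e f m s :=
  Submodule.span_mono (pairSet_anti h)

namespace IsHyperbolic

variable (hp : IsHyperbolic ω e f s)
include hp

theorem fe {j : ℕ} (hi : i < s) (hj : j < s) : ω (f i) (e j) = if i = j then -1 else 0 := by
  rw [apply_swap_eq_neg hp.isAlt (e j), hp.ef j hj i hi]
  grind

theorem apply_eq_zero (hi : i < m) (hm : m ≤ s) {v : M} (hv : v ∈ pairSpan R e f m s) :
    ω v (e i) = 0 ∧ ω v (f i) = 0 := by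
  suffices h : ∀ u ∈ pairSet e f m s, ω u (e i) = 0 ∧ ω u (f i) = 0 from
    ⟨LinearMap.eqOn_span (f := ω.flip (e i)) (g := 0) (fun u hu => (h u hu).1) hv,
      LinearMap.eqOn_span (f := ω.flip (f i)) (g := 0) (fun u hu => (h u hu).2) hv⟩
  rintro _ (⟨j, ⟨hj, hjs⟩, rfl⟩ | ⟨j, ⟨hj, hjs⟩, rfl⟩)
  · exact ⟨hp.ee j hjs i (by omega), by rw [hp.ef j hjs i (by omega), if_neg (by omega)]⟩
  · exact ⟨by rw [hp.fe hjs (by omega), if_neg (by omega)], hp.ff j hjs i (by omega)⟩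

theorem apply_eq_zero_of_mem_pairSpan_succ (hm : m < s) {b y : M} (hb : b = e m ∨ b = f m)
    (hy : y ∈ pairSpan R e f (m + 1) s) : ω y b = 0 := by
  have h := hp.apply_eq_zero (Nat.lt_succ_self m) hm hy
  rcases hb with rfl | rfl
  · exact h.1
  · exact h.2

theorem exists_mem_pairSpan_apply_eq_one {u : M} (hu : u ∈ pairSet e f m s) :
    ∃ u' ∈ pairSpan R e f m s, ω u' u = 1 := by
  obtain ⟨j, ⟨hmj, hj⟩, rfl⟩ | ⟨j, ⟨hmj, hj⟩, rfl⟩ := hu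
  · exact ⟨-f j, neg_mem (right_mem_pairSpan hmj hj), by simp [hp.fe hj hj]⟩
  · exact ⟨e j, left_mem_pairSpan hmj hj, by simp [hp.ef j hj j hj]⟩

theorem eq_sum {v : M} (hv : v ∈ pairSpan R e f m s) :
    v = ∑ i ∈ Finset.Ico m s, (ω v (f i) • e i - ω v (e i) • f i) := by
  let φ : M →ₗ[R] M := ∑ i ∈ Finset.Ico m s,
    ((ω.flip (f i)).smulRight (e i) - (ω.flip (e i)).smulRight (f i))
  have hφ (x : M) : φ x = ∑ i ∈ Finset.Ico m s, (ω x (f i) • e i - ω x (e i) • f i) := by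
    simp [φ]
  rw [← hφ]
  refine LinearMap.eqOn_span (f := LinearMap.id) (fun u hu => ?_) hv
  rw [LinearMap.id_apply, hφ]
  obtain ⟨j, hj, rfl⟩ | ⟨j, hj, rfl⟩ := hu <;>
  · rw [Finset.sum_eq_single_of_mem j (Finset.mem_Ico.mpr hj)]
    · simp [hp.ef j hj.2 j hj.2, hp.ee j hj.2 j hj.2, hp.fe hj.2 hj.2, hp.ff j hj.2 j hj.2]
    · intro i hi hij
      have his := (Finset.mem_Ico.mp hi).2
      simp [hp.ef j hj.2 i his, hp.ee j hj.2 i his, hp.fe hj.2 his, hp.ff j hj.2 i his, hij.symm]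

theorem mem_pairSpan_of_orthogonal {v : M} (hv : v ∈ pairSpan R e f 0 s)
    (h : ∀ i < m, ω v (e i) = 0 ∧ ω v (f i) = 0) : v ∈ pairSpan R e f m s := by
  rw [hp.eq_sum hv]
  refine sum_mem fun i hi => ?_
  have his := (Finset.mem_Ico.mp hi).2
  rcases lt_or_ge i m with him | him
  · simp [h i him]
  · exact sub_mem (Submodule.smul_mem _ _ (left_mem_pairSpan him his))
      (Submodule.smul_mem _ _ (right_mem_pairSpan him his))

theorem exists_eq_smul_sub_smul_add (hm : m < s) {v : M} (hv : v ∈ pairSpan R e f m s) :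
    ∃ y ∈ pairSpan R e f (m + 1) s, v = ω v (f m) • e m - ω v (e m) • f m + y := by
  refine ⟨∑ i ∈ Finset.Ico (m + 1) s, (ω v (f i) • e i - ω v (e i) • f i),
    sum_mem fun i hi => ?_, ?_⟩
  · obtain ⟨him, his⟩ := Finset.mem_Ico.mp hi
    exact sub_mem (Submodule.smul_mem _ _ (left_mem_pairSpan him his))
      (Submodule.smul_mem _ _ (right_mem_pairSpan him his))
  · rw [← Finset.sum_eq_sum_Ico_succ_bot hm fun i => ω v (f i) • e i - ω v (e i) • f i]
    exact hp.eq_sum hv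

theorem dvd_apply_of_mem_pairSpan {v t : M} (hv : v ∈ pairSpan R e f m s) {a : R}
    (h : ∀ u ∈ pairSet e f m s, a ∣ ω v u) : a ∣ ω v t := by
  rw [hp.eq_sum hv, map_sum, LinearMap.sum_apply]
  refine Finset.dvd_sum fun i hi => ?_
  obtain ⟨him, his⟩ := Finset.mem_Ico.mp hi
  rw [map_sub, map_smul, map_smul, LinearMap.sub_apply, LinearMap.smul_apply, LinearMap.smul_apply,
    smul_eq_mul, smul_eq_mul]
  exact dvd_sub (dvd_mul_of_dvd_left (h _ (right_mem_pairSet him his)) _)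
    (dvd_mul_of_dvd_left (h _ (left_mem_pairSet him his)) _)

end IsHyperbolic

namespace IsFormChain

variable {a : ℕ → M}

theorem isHyperbolic (hc : IsFormChain ω a (2 * s)) : IsHyperbolic ω (chainE a) (chainF a) s where
  isAlt := hc.isAlt
  ef i hi j hj := hc.chainE_chainF (by omega) (by omega)
  ee i hi j hj := hc.chainE_chainE (by omega) (by omega)
  ff i hi j hj := hc.chainF_chainF (by omega) (by omega)

end IsFormChain

theorem mem_pairSpan_chainE_chainF {a : ℕ → M} (hi : i < 2 * s) :
    a i ∈ pairSpan R (chainE a) (chainF a) 0 s := by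
  obtain ⟨k, rfl | rfl⟩ := i.even_or_odd'
  · rcases k with _ | k
    · simpa [chainE] using
        left_mem_pairSpan (R := R) (e := chainE a) (f := chainF a) le_rfl (show 0 < s by omega)
    · rw [mul_add_one, ← sub_eq_of_eq_add' (chainE_succ a k)]
      exact sub_mem (left_mem_pairSpan (Nat.zero_le _) (by omega))
        (left_mem_pairSpan (Nat.zero_le _) (by omega))
  · exact right_mem_pairSpan (e := chainE a) (Nat.zero_le _) (by omega)

end Hyperbolic

theorem exists_abs_add_two_mul_lt {a r : ℤ} (hr : r ≠ 0) (h : ¬(Even a ↔ Even r)) :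
    ∃ k : ℤ, |a + 2 * k * r| < |r| := by
  have hpos : 0 < (2 * r).natAbs := by omega
  obtain ⟨k, hk⟩ : 2 * r ∣ a.bmod (2 * r).natAbs - a :=
    Int.natAbs_dvd.mp Int.dvd_bmod_sub_self
  have hbmod : a + 2 * k * r = a.bmod (2 * r).natAbs := by linarith
  have hle : |a + 2 * k * r| ≤ |r| := by
    have := Int.le_bmod (x := a) hpos
    have := Int.bmod_lt (x := a) hpos
    rw [hbmod, Int.abs_eq_natAbs, Int.abs_eq_natAbs]
    omega
  refine ⟨k, lt_of_le_of_ne hle fun heq => h ?_⟩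
  rw [← even_abs (a := r), ← heq, even_abs, mul_assoc]
  simp [parity_simps]

section LevelTwo

variable {M : Type*} [AddCommGroup M] {ω : LinearMap.BilinForm ℤ M}

theorem transv_two_mul_mem (hω : ω.IsAlt) {K : Subgroup (M ≃ₗ[ℤ] M)} {v : M}
    (hv : transv ω hω v 2 ∈ K) (k : ℤ) : transv ω hω v (2 * k) ∈ K := by
  simpa [mul_comm] using transv_intCast_mul_mem hω hv k

theorem exists_mem_eq_eichler_two_smul (hω : ω.IsAlt) {K : Subgroup (M ≃ₗ[ℤ] M)} {b : M}
    {B : Set M} (hb : transv ω hω b 2 ∈ K)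
    (hB : ∀ u ∈ B, ω u b = 0 ∧ transv ω hω u 2 ∈ K ∧
      (transv ω hω (b + u) 2 ∈ K ∨ transv ω hω (u - b) 2 ∈ K))
    {y : M} (hy : y ∈ Submodule.span ℤ B) :
    ω y b = 0 ∧ ∃ h ∈ K, (h : M →ₗ[ℤ] M) = eichler ω b ((2 : ℤ) • y) := by
  rw [← Submodule.mem_toAddSubgroup, Submodule.span_int_eq_addSubgroupClosure] at hy
  have add_of {y z : M} (hyb : ω y b = 0) (hzb : ω z b = 0)
      (hy : ∃ h ∈ K, (h : M →ₗ[ℤ] M) = eichler ω b ((2 : ℤ) • y))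
      (hz : ∃ h ∈ K, (h : M →ₗ[ℤ] M) = eichler ω b ((2 : ℤ) • z)) :
      ∃ h ∈ K, (h : M →ₗ[ℤ] M) = eichler ω b ((2 : ℤ) • (y + z)) := by
    obtain ⟨g, hg, hgy⟩ := hy
    obtain ⟨h, hh, hhz⟩ := hz
    refine ⟨_, mul_mem (transv_two_mul_mem hω hb (-(2 * ω z y))) (mul_mem hg hh), ?_⟩
    rw [smul_add, eichler_add hω (by simp [hyb]) (by simp [hzb]), ← hgy, ← hhz, map_smul, map_smul,
      LinearMap.smul_apply, smul_eq_mul, smul_eq_mul, mul_neg]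
    rfl
  induction hy using AddSubgroup.closure_induction with
  | mem u hu =>
    obtain ⟨hub, hu2, hadd | hsub⟩ := hB u hu
    · exact ⟨hub, _, mul_mem hadd (inv_mem (mul_mem hb hu2)),
        (eichler_two_smul_eq_of_add hω hub).symm⟩
    · exact ⟨hub, _, mul_mem (inv_mem hsub) (mul_mem hb hu2),
        (eichler_two_smul_eq_of_sub hω hub).symm⟩
  | zero => exact ⟨by simp, 1, one_mem _, by rw [smul_zero, eichler_zero]; rfl⟩
  | add y z _ _ hy hz => exact ⟨by simp [hy.1, hz.1], add_of hy.1 hz.1 hy.2 hz.2⟩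
  | neg y _ hy =>
    obtain ⟨hyb, h, hh, hhy⟩ := hy
    refine ⟨by simp [hyb], h⁻¹, inv_mem hh, ?_⟩
    have hinv : eichler ω b ((2 : ℤ) • y) ∘ₗ eichler ω b ((2 : ℤ) • -y) = LinearMap.id := by
      have := eichler_add hω (b := b) (y := (2 : ℤ) • y) (z := (2 : ℤ) • -y) (by simp [hyb])
        (by simp [hyb])
      rw [← smul_add, add_neg_cancel, smul_zero, eichler_zero] at this
      rw [this]
      simp [hω y, transv_zero]
    ext x
    rw [LinearEquiv.coe_coe, LinearEquiv.coe_inv, LinearEquiv.symm_apply_eq, ← LinearEquiv.coe_coe,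
      hhy, ← LinearMap.comp_apply, hinv, LinearMap.id_apply]

/-- The vectors `e i`, `f i`, `e i + f j`, `e j - e i` and `f i + f j` with indices from `m` to
below `s`, and `i < j` in the last two families. For a hyperbolic system `e`, `f` their squared
transvections generate the level 2 congruence subgroup of the symplectic group of its span. -/
inductive IsLevelTwoRoot (e f : ℕ → M) (m s : ℕ) : M → Prop
  | left {i : ℕ} (hm : m ≤ i) (hi : i < s) : IsLevelTwoRoot e f m s (e i)
  | right {i : ℕ} (hm : m ≤ i) (hi : i < s) : IsLevelTwoRoot e f m s (f i)
  | left_add_right {i j : ℕ} (hmi : m ≤ i) (hi : i < s) (hmj : m ≤ j) (hj : j < s) :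
    IsLevelTwoRoot e f m s (e i + f j)
  | left_sub_left {i j : ℕ} (hm : m ≤ i) (hij : i < j) (hj : j < s) :
    IsLevelTwoRoot e f m s (e j - e i)
  | right_add_right {i j : ℕ} (hm : m ≤ i) (hij : i < j) (hj : j < s) :
    IsLevelTwoRoot e f m s (f i + f j)

/-- The group generated by the squared transvections of the vectors singled out by
`IsLevelTwoRoot`. -/
def levelTwoGroup (hω : ω.IsAlt) (e f : ℕ → M) (m s : ℕ) : Subgroup (M ≃ₗ[ℤ] M) :=
  Subgroup.closure ((fun u => transv ω hω u 2) '' {u | IsLevelTwoRoot e f m s u})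

variable {e f : ℕ → M} {m s : ℕ}

theorem IsLevelTwoRoot.anti {n : ℕ} (hmn : m ≤ n) {u : M} (hu : IsLevelTwoRoot e f n s u) :
    IsLevelTwoRoot e f m s u := by
  cases hu with
  | left hm hi => exact .left (hmn.trans hm) hi
  | right hm hi => exact .right (hmn.trans hm) hi
  | left_add_right hmi hi hmj hj => exact .left_add_right (hmn.trans hmi) hi (hmn.trans hmj) hj
  | left_sub_left hm hij hj => exact .left_sub_left (hmn.trans hm) hij hj
  | right_add_right hm hij hj => exact .right_add_right (hmn.trans hm) hij hj

theorem IsLevelTwoRoot.mem_pairSpan {u : M} (hu : IsLevelTwoRoot e f m s u) :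
    u ∈ pairSpan ℤ e f m s := by
  cases hu with
  | left hm hi => exact left_mem_pairSpan hm hi
  | right hm hi => exact right_mem_pairSpan hm hi
  | left_add_right hmi hi hmj hj =>
    exact add_mem (left_mem_pairSpan hmi hi) (right_mem_pairSpan hmj hj)
  | left_sub_left hm hij hj =>
    exact sub_mem (left_mem_pairSpan (hm.trans hij.le) hj) (left_mem_pairSpan hm (hij.trans hj))
  | right_add_right hm hij hj =>
    exact add_mem (right_mem_pairSpan hm (hij.trans hj)) (right_mem_pairSpan (hm.trans hij.le) hj)

section

variable {hω : ω.IsAlt}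

theorem levelTwoGroup_anti {n : ℕ} (hmn : m ≤ n) :
    levelTwoGroup hω e f n s ≤ levelTwoGroup hω e f m s :=
  Subgroup.closure_mono (Set.image_mono fun _ hu => hu.anti hmn)

theorem transv_mem_levelTwoGroup {u : M} (hu : IsLevelTwoRoot e f m s u) :
    transv ω hω u 2 ∈ levelTwoGroup hω e f m s :=
  Subgroup.subset_closure ⟨u, hu, rfl⟩

theorem levelTwoGroup_le {H : Subgroup (M ≃ₗ[ℤ] M)}
    (h : ∀ u, IsLevelTwoRoot e f m s u → transv ω hω u 2 ∈ H) : levelTwoGroup hω e f m s ≤ H := by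
  rw [levelTwoGroup, Subgroup.closure_le]
  rintro _ ⟨u, hu, rfl⟩
  exact h u hu

theorem levelTwoGroup_le_isometries : levelTwoGroup hω e f m s ≤ isometries ω :=
  levelTwoGroup_le fun u _ => transv_mem_isometries hω u 2

theorem exists_eq_add_two_smul_of_mem_levelTwoGroup {h : M ≃ₗ[ℤ] M}
    (hh : h ∈ levelTwoGroup hω e f m s) (x : M) :
    ∃ w ∈ pairSpan ℤ e f m s, h x = x + (2 : ℤ) • w := by
  induction hh using Subgroup.closure_induction'' generalizing x with
  | one => exact ⟨0, zero_mem _, by simp⟩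
  | mem _ hg =>
    obtain ⟨u, hu, rfl⟩ := hg
    exact ⟨ω x u • u, Submodule.smul_mem _ _ hu.mem_pairSpan, by
      rw [transv_apply, mul_smul]⟩
  | inv_mem _ hg =>
    obtain ⟨u, hu, rfl⟩ := hg
    exact ⟨-ω x u • u, Submodule.smul_mem _ _ hu.mem_pairSpan, by
      rw [transv_inv, transv_apply, smul_smul, mul_neg, neg_mul]⟩
  | mul g h _ _ hg hh =>
    obtain ⟨w, hw, hx⟩ := hh x
    obtain ⟨w', hw', hgx⟩ := hg (h x)
    exact ⟨w + w', add_mem hw hw', by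
      rw [LinearEquiv.mul_apply, hgx, hx, smul_add, add_assoc]⟩

theorem apply_eq_of_mem_levelTwoGroup {h : M ≃ₗ[ℤ] M} (hh : h ∈ levelTwoGroup hω e f m s) {x : M}
    (hx : ∀ u ∈ pairSpan ℤ e f m s, ω x u = 0) : h x = x := by
  suffices levelTwoGroup hω e f m s ≤ MulAction.stabilizer (M ≃ₗ[ℤ] M) x from this hh
  exact levelTwoGroup_le fun u hu => transv_apply_of_eq_zero hω (hx u hu.mem_pairSpan) 2

end

end LevelTwo

namespace IsHyperbolic

variable {M : Type*} [AddCommGroup M] {ω : LinearMap.BilinForm ℤ M} {e f : ℕ → M} {m s : ℕ}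
  (hp : IsHyperbolic ω e f s) (hm : m < s)
include hp hm

theorem exists_mem_levelTwoGroup_eq_eichler {b y : M} (hb : b = e m ∨ b = f m)
    (hy : y ∈ pairSpan ℤ e f (m + 1) s) :
    ∃ h ∈ levelTwoGroup hp.isAlt e f m s, (h : M →ₗ[ℤ] M) = eichler ω b ((2 : ℤ) • y) := by
  have hbK : IsLevelTwoRoot e f m s b := by
    rcases hb with rfl | rfl
    · exact .left le_rfl hm
    · exact .right le_rfl hm
  refine (exists_mem_eq_eichler_two_smul hp.isAlt (transv_mem_levelTwoGroup hbK)
    (fun u hu => ⟨hp.apply_eq_zero_of_mem_pairSpan_succ hm hb (Submodule.subset_span hu), ?_⟩)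
    hy).2
  obtain ⟨j, ⟨hmj, hj⟩, rfl⟩ | ⟨j, ⟨hmj, hj⟩, rfl⟩ := hu
  · refine ⟨transv_mem_levelTwoGroup (.left (by omega) hj), ?_⟩
    rcases hb with rfl | rfl
    · exact Or.inr (transv_mem_levelTwoGroup (.left_sub_left le_rfl hmj hj))
    · rw [add_comm (f m)]
      exact Or.inl (transv_mem_levelTwoGroup (.left_add_right (by omega) hj le_rfl hm))
  · refine ⟨transv_mem_levelTwoGroup (.right (by omega) hj), Or.inl ?_⟩
    rcases hb with rfl | rfl
    · exact transv_mem_levelTwoGroup (.left_add_right le_rfl hm (by omega) hj)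
    · exact transv_mem_levelTwoGroup (.right_add_right le_rfl hmj hj)

theorem exists_mem_levelTwoGroup_apply_right {u : M} (hu : u = e m ∨ u ∈ pairSet e f (m + 1) s)
    (k : ℤ) :
    ∃ h ∈ levelTwoGroup hp.isAlt e f m s, ∀ x, ω (h x) (f m) = ω x (f m) + 2 * k * ω x u := by
  have hef : ω (e m) (f m) = 1 := by rw [hp.ef m hm m hm, if_pos rfl]
  rcases hu with rfl | hu
  · exact ⟨_, transv_two_mul_mem hp.isAlt (transv_mem_levelTwoGroup (.left le_rfl hm)) k,
      fun x => by simp [transv_apply, hef]⟩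
  · have huf := hp.apply_eq_zero_of_mem_pairSpan_succ hm (Or.inr rfl) (Submodule.subset_span hu)
    obtain ⟨h, hh, hhu⟩ := hp.exists_mem_levelTwoGroup_eq_eichler hm (Or.inl rfl)
      (Submodule.smul_mem _ k (Submodule.subset_span hu))
    refine ⟨h, hh, fun x => ?_⟩
    rw [← LinearEquiv.coe_coe, hhu, eichler_apply]
    simp only [map_add, map_smul, LinearMap.add_apply, LinearMap.smul_apply, huf, hef, smul_eq_mul]
    ring

theorem exists_mem_levelTwoGroup_apply_of_mem {u : M}
    (hu : u = e m ∨ u ∈ pairSet e f (m + 1) s) (k : ℤ) :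
    ∃ h ∈ levelTwoGroup hp.isAlt e f m s,
      ∀ x, ω (h x) (f m) = ω x (f m) ∧ ω (h x) u = ω x u + 2 * k * ω x (f m) := by
  have hff := hp.isAlt (f m)
  rcases hu with rfl | hu
  · refine ⟨_, transv_two_mul_mem hp.isAlt (transv_mem_levelTwoGroup (.right le_rfl hm)) (-k),
      fun x => ?_⟩
    simp [transv_apply, hff, hp.fe hm hm]
  · obtain ⟨u', hu', hu'u⟩ := hp.exists_mem_pairSpan_apply_eq_one hu
    obtain ⟨h, hh, hhu⟩ := hp.exists_mem_levelTwoGroup_eq_eichler hm (Or.inr rfl)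
      (Submodule.smul_mem _ k hu')
    have hu'f := hp.apply_eq_zero_of_mem_pairSpan_succ hm (Or.inr rfl) hu'
    have hfu : ω (f m) u = 0 := by
      rw [apply_swap_eq_neg hp.isAlt u, neg_eq_zero]
      exact hp.apply_eq_zero_of_mem_pairSpan_succ hm (Or.inr rfl) (Submodule.subset_span hu)
    refine ⟨h, hh, fun x => ?_⟩
    rw [← LinearEquiv.coe_coe, hhu, eichler_apply]
    simp only [map_add, map_smul, LinearMap.add_apply, LinearMap.smul_apply, hu'f, hff, hfu, hu'u,
      smul_eq_mul]
    constructor <;> ring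

theorem exists_mem_levelTwoGroup_abs_apply_lt {v u : M}
    (hu : u = e m ∨ u ∈ pairSet e f (m + 1) s) (hodd : Odd (ω v (f m))) (heven : Even (ω v u))
    (hdvd : ¬ω v (f m) ∣ ω v u) :
    ∃ h ∈ levelTwoGroup hp.isAlt e f m s, |ω (h v) (f m)| < |ω v (f m)| := by
  have hne : ω v (f m) ≠ 0 := fun h => by simp [h] at hodd
  obtain ⟨k, hk⟩ := exists_abs_add_two_mul_lt (a := ω v u) hne
    (by simp [heven, Int.not_even_iff_odd.mpr hodd])
  obtain ⟨g, hg, hgv⟩ := hp.exists_mem_levelTwoGroup_apply_of_mem hm hu k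
  rw [← (hgv v).2] at hk
  have hne' : ω (g v) u ≠ 0 := fun h => hdvd <| by
    rw [(hgv v).2] at h
    exact (dvd_add_left (Dvd.intro_left _ rfl)).mp (h ▸ dvd_zero _)
  obtain ⟨l, hl⟩ := exists_abs_add_two_mul_lt (a := ω (g v) (f m)) hne' (by
    rw [(hgv v).1, (hgv v).2]
    simp [heven, Int.not_even_iff_odd.mpr hodd, parity_simps])
  obtain ⟨h, hh, hhv⟩ := hp.exists_mem_levelTwoGroup_apply_right hm hu l
  exact ⟨h * g, mul_mem hh hg, by
    rw [LinearEquiv.mul_apply, hhv]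
    exact hl.trans hk⟩

theorem exists_mem_levelTwoGroup_apply_eq_neg :
    ∃ h ∈ levelTwoGroup hp.isAlt e f m s, ∀ x, ω (h x) (f m) = -ω x (f m) := by
  have hee := hp.isAlt (e m)
  have hff := hp.isAlt (f m)
  have hef : ω (e m) (f m) = 1 := by rw [hp.ef m hm m hm, if_pos rfl]
  have hfe : ω (f m) (e m) = -1 := by rw [hp.fe hm hm, if_pos rfl]
  refine ⟨_, mul_mem (mul_mem (transv_mem_levelTwoGroup (.right le_rfl hm))
    (transv_mem_levelTwoGroup (.left le_rfl hm)))
    (transv_mem_levelTwoGroup (.left_add_right le_rfl hm le_rfl hm)), fun x => ?_⟩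
  simp only [LinearEquiv.mul_apply, transv_apply, map_add, map_smul, LinearMap.add_apply,
    LinearMap.smul_apply, hee, hff, hef, hfe, smul_eq_mul]
  ring

theorem exists_mem_levelTwoGroup_apply_eq_one {v w t : M} (hw : w ∈ pairSpan ℤ e f m s)
    (hv : v = e m + (2 : ℤ) • w) (ht : ω v t = 1) :
    ∃ h ∈ levelTwoGroup hp.isAlt e f m s, ω (h v) (f m) = 1 := by
  obtain ⟨h, hh, hmin⟩ := exists_minimalFor_of_wellFoundedLT
    (· ∈ levelTwoGroup hp.isAlt e f m s) (fun h => (ω (h v) (f m)).natAbs) ⟨1, one_mem _⟩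
  obtain ⟨w', hw', hhv⟩ := exists_eq_add_two_smul_of_mem_levelTwoGroup hh v
  have hhv : h v = e m + (2 : ℤ) • (w + w') := by rw [hhv, hv, smul_add, add_assoc]
  have hef : ω (e m) (f m) = 1 := by rw [hp.ef m hm m hm, if_pos rfl]
  have hodd : Odd (ω (h v) (f m)) := by simp [hhv, hef, parity_simps]
  have hdvd {u : M} (hu : u = e m ∨ u ∈ pairSet e f (m + 1) s) : ω (h v) (f m) ∣ ω (h v) u := by
    have heu : ω (e m) u = 0 := by
      rcases hu with rfl | hu
      · exact hp.isAlt _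
      · rw [apply_swap_eq_neg hp.isAlt u, neg_eq_zero]
        exact hp.apply_eq_zero_of_mem_pairSpan_succ hm (Or.inl rfl) (Submodule.subset_span hu)
    by_contra hndvd
    obtain ⟨g, hg, hlt⟩ := hp.exists_mem_levelTwoGroup_abs_apply_lt hm hu hodd
      (by simp [hhv, heu, parity_simps]) hndvd
    rw [Int.abs_eq_natAbs, Int.abs_eq_natAbs] at hlt
    have hle := hmin (mul_mem hg hh)
    simp only [LinearEquiv.mul_apply] at hle
    omega
  have hunit : ω (h v) (f m) ∣ 1 := by
    rw [← ht, ← levelTwoGroup_le_isometries hh v t]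
    refine hp.dvd_apply_of_mem_pairSpan (m := m) ?_ fun u hu => ?_
    · rw [hhv]
      exact add_mem (left_mem_pairSpan le_rfl hm) (Submodule.smul_mem _ _ (add_mem hw hw'))
    · rcases eq_or_mem_pairSet_succ hu with rfl | rfl | hu
      · exact hdvd (Or.inl rfl)
      · exact dvd_rfl
      · exact hdvd (Or.inr hu)
  rcases Int.isUnit_iff.mp (isUnit_of_dvd_one hunit) with hone | hneg
  · exact ⟨h, hh, hone⟩
  · obtain ⟨g, hg, hgneg⟩ := hp.exists_mem_levelTwoGroup_apply_eq_neg hm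
    exact ⟨g * h, mul_mem hg hh, by rw [LinearEquiv.mul_apply, hgneg, hneg, neg_neg]⟩

theorem exists_mem_levelTwoGroup_apply_add_eq {b x y : M} (hb : b = e m ∨ b = f m)
    (hxb : ω x b * ω x b = 1) (hxy : ω x y = 0) (hy : y ∈ pairSpan ℤ e f (m + 1) s) (k : ℤ) :
    ∃ h ∈ levelTwoGroup hp.isAlt e f m s, h b = b ∧ h (x + (2 * k) • b + (2 : ℤ) • y) = x := by
  have hyb := hp.apply_eq_zero_of_mem_pairSpan_succ hm hb hy
  have hby : ω b y = 0 := by rw [apply_swap_eq_neg hp.isAlt y, hyb, neg_zero]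
  have hbb := hp.isAlt b
  have hbK : IsLevelTwoRoot e f m s b := by
    rcases hb with rfl | rfl
    · exact .left le_rfl hm
    · exact .right le_rfl hm
  obtain ⟨h, hh, hhy⟩ := hp.exists_mem_levelTwoGroup_eq_eichler hm hb
    (Submodule.smul_mem _ (-ω x b) hy)
  refine ⟨_, mul_mem (transv_two_mul_mem hp.isAlt (transv_mem_levelTwoGroup hbK) (-ω x b * k)) hh,
    ?_, ?_⟩ <;>
  rw [LinearEquiv.mul_apply, ← LinearEquiv.coe_coe h, hhy, eichler_apply, transv_apply]
  · simp [hbb, hby]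
  · rcases mul_self_eq_one_iff.mp hxb with h | h <;>
    · simp only [map_add, map_smul, LinearMap.add_apply, LinearMap.smul_apply, hxy, hyb, hby, hbb,
        hp.isAlt y, smul_eq_mul, h]
      module

theorem exists_mem_levelTwoGroup_apply_eq_left {v w t : M} (hw : w ∈ pairSpan ℤ e f m s)
    (hv : v = e m + (2 : ℤ) • w) (ht : ω v t = 1) :
    ∃ h ∈ levelTwoGroup hp.isAlt e f m s, h v = e m := by
  obtain ⟨g, hg, hgv⟩ := hp.exists_mem_levelTwoGroup_apply_eq_one hm hw hv ht
  obtain ⟨w', hw', hgw⟩ := exists_eq_add_two_smul_of_mem_levelTwoGroup hg v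
  obtain ⟨y, hy, hwy⟩ := hp.exists_eq_smul_sub_smul_add hm (add_mem hw hw')
  have hef : ω (e m) (f m) = 1 := by rw [hp.ef m hm m hm, if_pos rfl]
  have hgv' : g v = e m + (2 : ℤ) • (w + w') := by rw [hgw, hv, smul_add, add_assoc]
  have hzero : ω (w + w') (f m) = 0 := by
    rw [hgv', map_add, map_smul, LinearMap.add_apply, LinearMap.smul_apply, hef, smul_eq_mul] at hgv
    omega
  have hye : ω (e m) y = 0 := by
    rw [apply_swap_eq_neg hp.isAlt y,
      hp.apply_eq_zero_of_mem_pairSpan_succ hm (Or.inl rfl) hy, neg_zero]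
  obtain ⟨h, hh, -, hhe⟩ := hp.exists_mem_levelTwoGroup_apply_add_eq hm (Or.inr rfl)
    (by rw [hef, one_mul]) hye hy (-ω (w + w') (e m))
  refine ⟨h * g, mul_mem hh hg, ?_⟩
  rw [hzero] at hwy
  refine Eq.trans (congrArg h ?_) hhe
  linear_combination (norm := module) hgv' + (2 : ℤ) • hwy

theorem exists_mem_levelTwoGroup_apply_eq_right {v w : M} (hw : w ∈ pairSpan ℤ e f m s)
    (hv : v = f m + (2 : ℤ) • w) (hev : ω (e m) v = 1) :
    ∃ h ∈ levelTwoGroup hp.isAlt e f m s, h (e m) = e m ∧ h v = f m := by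
  obtain ⟨y, hy, hwy⟩ := hp.exists_eq_smul_sub_smul_add hm hw
  have hef : ω (e m) (f m) = 1 := by rw [hp.ef m hm m hm, if_pos rfl]
  have hzero : ω w (e m) = 0 := by
    rw [hv, map_add, map_smul, hef, apply_swap_eq_neg hp.isAlt w, smul_eq_mul] at hev
    omega
  have hyf : ω (f m) y = 0 := by
    rw [apply_swap_eq_neg hp.isAlt y,
      hp.apply_eq_zero_of_mem_pairSpan_succ hm (Or.inr rfl) hy, neg_zero]
  obtain ⟨h, hh, hhe, hhf⟩ := hp.exists_mem_levelTwoGroup_apply_add_eq hm (Or.inl rfl)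
    (by simp [hp.fe hm hm]) hyf hy (ω w (f m))
  rw [hzero] at hwy
  refine ⟨h, hh, hhe, Eq.trans (congrArg h ?_) hhf⟩
  linear_combination (norm := module) hv + (2 : ℤ) • hwy

omit hm

theorem mem_pairSpan_of_isometry {g : M ≃ₗ[ℤ] M} (hg : g ∈ isometries ω) (hm : m ≤ s)
    (hfix : ∀ i < m, g (e i) = e i ∧ g (f i) = f i) {u w : M} (hu : u ∈ pairSpan ℤ e f m s)
    (hw : w ∈ pairSpan ℤ e f 0 s) (hgu : g u = u + (2 : ℤ) • w) : w ∈ pairSpan ℤ e f m s := by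
  refine hp.mem_pairSpan_of_orthogonal hw fun i hi => ?_
  obtain ⟨hue, huf⟩ := hp.apply_eq_zero hi hm hu
  have he := hg u (e i)
  have hf := hg u (f i)
  rw [(hfix i hi).1, hgu] at he
  rw [(hfix i hi).2, hgu] at hf
  simp_all

theorem exists_mem_levelTwoGroup_mul_apply {g : M ≃ₗ[ℤ] M} (hm : m < s) (hg : g ∈ isometries ω)
    (hg2 : ∀ v ∈ pairSpan ℤ e f 0 s, ∃ w ∈ pairSpan ℤ e f 0 s, g v = v + (2 : ℤ) • w)
    (hfix : ∀ i < m, g (e i) = e i ∧ g (f i) = f i) :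
    ∃ h ∈ levelTwoGroup hp.isAlt e f m s, h (g (e m)) = e m ∧ h (g (f m)) = f m := by
  have hem : e m ∈ pairSpan ℤ e f m s := left_mem_pairSpan le_rfl hm
  have hfm : f m ∈ pairSpan ℤ e f m s := right_mem_pairSpan le_rfl hm
  obtain ⟨w, hw, hgw⟩ := hg2 (e m) (pairSpan_anti (Nat.zero_le m) hem)
  obtain ⟨w', hw', hgw'⟩ := hg2 (f m) (pairSpan_anti (Nat.zero_le m) hfm)
  replace hw := hp.mem_pairSpan_of_isometry hg hm.le hfix hem hw hgw
  replace hw' := hp.mem_pairSpan_of_isometry hg hm.le hfix hfm hw' hgw'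
  have hef : ω (g (e m)) (g (f m)) = 1 := by rw [hg, hp.ef m hm m hm, if_pos rfl]
  obtain ⟨h, hh, hhe⟩ := hp.exists_mem_levelTwoGroup_apply_eq_left hm hw hgw hef
  obtain ⟨y, hy, hhy⟩ := exists_eq_add_two_smul_of_mem_levelTwoGroup hh (g (f m))
  obtain ⟨k, hk, hke, hkf⟩ := hp.exists_mem_levelTwoGroup_apply_eq_right hm (v := h (g (f m)))
    (add_mem hw' hy) (by rw [hhy, hgw', smul_add, add_assoc])
    (by rw [← hhe, levelTwoGroup_le_isometries hh, hef])
  exact ⟨k * h, mul_mem hk hh, by rw [LinearEquiv.mul_apply, hhe, hke],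
    by rw [LinearEquiv.mul_apply, hkf]⟩

theorem exists_mem_levelTwoGroup_forall_apply {g : M ≃ₗ[ℤ] M} (hg : g ∈ isometries ω)
    (hg2 : ∀ v ∈ pairSpan ℤ e f 0 s, ∃ w ∈ pairSpan ℤ e f 0 s, g v = v + (2 : ℤ) • w)
    (hm : m ≤ s) :
    ∃ h ∈ levelTwoGroup hp.isAlt e f 0 s, ∀ i < m, h (g (e i)) = e i ∧ h (g (f i)) = f i := by
  induction m with
  | zero => exact ⟨1, one_mem _, by simp⟩
  | succ m ih =>
    obtain ⟨h, hh, hfix⟩ := ih (by omega)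
    obtain ⟨k, hk, hke, hkf⟩ := hp.exists_mem_levelTwoGroup_mul_apply (g := h * g) hm
      (mul_mem (levelTwoGroup_le_isometries hh) hg) (fun v hv => by
        obtain ⟨w, hw, hgv⟩ := hg2 v hv
        obtain ⟨w', hw', hhv⟩ := exists_eq_add_two_smul_of_mem_levelTwoGroup hh (g v)
        exact ⟨w + w', add_mem hw hw', by
          rw [LinearEquiv.mul_apply, hhv, hgv, smul_add, add_assoc]⟩) hfix
    refine ⟨k * h, mul_mem (levelTwoGroup_anti (Nat.zero_le m) hk) hh, fun i hi => ?_⟩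
    have hfixed {x : M} (hx : ∀ u ∈ pairSpan ℤ e f m s, ω u x = 0) : k x = x :=
      apply_eq_of_mem_levelTwoGroup hk fun u hu => by
        rw [apply_swap_eq_neg hp.isAlt u, hx u hu, neg_zero]
    rcases Nat.lt_succ_iff_lt_or_eq.mp hi with him | rfl
    · rw [LinearEquiv.mul_apply, LinearEquiv.mul_apply, (hfix i him).1, (hfix i him).2]
      exact ⟨hfixed fun u hu => (hp.apply_eq_zero him (by omega) hu).1,
        hfixed fun u hu => (hp.apply_eq_zero him (by omega) hu).2⟩
    · exact ⟨hke, hkf⟩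

theorem exists_mem_levelTwoGroup_eqOn {g : M ≃ₗ[ℤ] M} (hg : g ∈ isometries ω)
    (hg2 : ∀ v ∈ pairSpan ℤ e f 0 s, ∃ w ∈ pairSpan ℤ e f 0 s, g v = v + (2 : ℤ) • w) :
    ∃ h ∈ levelTwoGroup hp.isAlt e f 0 s, Set.EqOn h g (pairSpan ℤ e f 0 s) := by
  obtain ⟨h, hh, hfix⟩ := hp.exists_mem_levelTwoGroup_forall_apply hg hg2 le_rfl
  refine ⟨h⁻¹, inv_mem hh, fun v hv => ?_⟩
  refine LinearMap.eqOn_span (f := (h⁻¹ : M ≃ₗ[ℤ] M).toLinearMap) (g := g.toLinearMap) ?_ hv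
  rintro _ (⟨i, ⟨-, hi⟩, rfl⟩ | ⟨i, ⟨-, hi⟩, rfl⟩) <;>
    simp only [LinearEquiv.coe_coe, LinearEquiv.coe_inv, LinearEquiv.symm_apply_eq, hfix i hi]

end IsHyperbolic

theorem IsFormChain.mem_of_forall_exists_eq_add_two_smul {M : Type*} [AddCommGroup M]
    {ω : LinearMap.BilinForm ℤ M} {a : ℕ → M} {s : ℕ} (hc : IsFormChain ω a (2 * s))
    (hspan : Submodule.span ℤ (a '' Set.Iio (2 * s)) = ⊤) {H : Subgroup (M ≃ₗ[ℤ] M)}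
    (hH : ∀ i < 2 * s, transv ω hc.isAlt (a i) 1 ∈ H) {g : M ≃ₗ[ℤ] M} (hg : g ∈ isometries ω)
    (hg2 : ∀ v, ∃ w, g v = v + (2 : ℤ) • w) : g ∈ H := by
  have htop : pairSpan ℤ (chainE a) (chainF a) 0 s = ⊤ := by
    rw [← top_le_iff, ← hspan, Submodule.span_le]
    exact Set.image_subset_iff.2 fun i hi => mem_pairSpan_chainE_chainF hi
  obtain ⟨h, hh, hhg⟩ := hc.isHyperbolic.exists_mem_levelTwoGroup_eqOn hg fun v _ => by
    simpa [htop] using hg2 v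
  rw [htop] at hhg
  rw [← LinearEquiv.ext fun v => hhg (Set.mem_univ v)]
  refine levelTwoGroup_le (fun u hu => ?_) hh
  cases hu with
  | left _ hi => exact hc.transv_chainE_mem hH (by omega)
  | right _ hi => exact hc.transv_chainF_mem hH (by omega)
  | left_add_right _ hi _ hj => exact hc.transv_chainE_add_chainF_mem hH (by omega) (by omega)
  | left_sub_left _ hij hj => exact hc.transv_chainE_sub_mem hH hij (by omega)
  | right_add_right _ hij hj => exact hc.transv_chainF_add_chainF_mem hH hij (by omega)

theorem ncard_orbit_mul_card_inf_stabilizer {G α : Type*} [Group G] [MulAction G α]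
    (K : Subgroup G) (x : α) :
    (MulAction.orbit K x).ncard * Nat.card ↥(K ⊓ MulAction.stabilizer G x) = Nat.card K := by
  rw [← MulAction.index_stabilizer, ← Subgroup.relIndex_bot_left, ← Subgroup.relIndex_bot_left K,
    ← Subgroup.relIndex_mul_relIndex ⊥ _ K bot_le inf_le_left, Subgroup.inf_relIndex_left, mul_comm]
  rfl

section FixPairs

variable {R M : Type*} [CommRing R] [AddCommGroup M] [Module R M] {ω : LinearMap.BilinForm R M}
  {Γ : Subgroup (M ≃ₗ[R] M)} {e f : ℕ → M} {s m : ℕ}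

/-- The members of a group of linear automorphisms which fix `e i` and `f i` for `i < m`. -/
def fixPairs (Γ : Subgroup (M ≃ₗ[R] M)) (e f : ℕ → M) (m : ℕ) : Subgroup (M ≃ₗ[R] M) :=
  Γ ⊓ fixingSubgroup (M ≃ₗ[R] M) (pairSet e f 0 m)

theorem mem_fixPairs {g : M ≃ₗ[R] M} :
    g ∈ fixPairs Γ e f m ↔ g ∈ Γ ∧ ∀ i < m, g (e i) = e i ∧ g (f i) = f i := by
  simp only [fixPairs, Subgroup.mem_inf, mem_fixingSubgroup_iff, LinearEquiv.smul_def, pairSet,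
    Set.mem_union, or_imp, forall_and, Set.forall_mem_image, Set.mem_Ico, Nat.zero_le, true_and]

theorem fixPairs_zero : fixPairs Γ e f 0 = Γ := by
  ext g
  simp [mem_fixPairs]

theorem fixPairs_succ : fixPairs Γ e f (m + 1) = fixPairs Γ e f m ⊓
    MulAction.stabilizer (M ≃ₗ[R] M) (e m) ⊓ MulAction.stabilizer (M ≃ₗ[R] M) (f m) := by
  ext g
  simp only [mem_fixPairs, Nat.lt_succ_iff_lt_or_eq, or_imp, forall_and, forall_eq,
    Subgroup.mem_inf, MulAction.mem_stabilizer_iff, LinearEquiv.smul_def]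
  tauto

namespace IsHyperbolic

variable (hp : IsHyperbolic ω e f s)
include hp

theorem transv_mem_fixPairs (hΓ : ∀ v c, transv ω hp.isAlt v c ∈ Γ) (hm : m ≤ s) {v : M}
    (hv : v ∈ pairSpan R e f m s) (c : R) : transv ω hp.isAlt v c ∈ fixPairs Γ e f m := by
  refine mem_fixPairs.mpr ⟨hΓ v c, fun i hi => ?_⟩
  obtain ⟨he, hf⟩ := hp.apply_eq_zero hi hm hv
  constructor <;> apply transv_apply_of_eq_zero <;> rw [apply_swap_eq_neg hp.isAlt v] <;>
    simp only [he, hf, neg_zero]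

theorem apply_mem_of_mem_fixPairs (hL : pairSpan R e f 0 s = ⊤) (hΓ : Γ ≤ isometries ω)
    (hm : m ≤ s) {g : M ≃ₗ[R] M} (hg : g ∈ fixPairs Γ e f m) {v : M}
    (hv : v ∈ pairSpan R e f m s) : g v ∈ pairSpan R e f m s := by
  obtain ⟨hgΓ, hfix⟩ := mem_fixPairs.mp hg
  refine hp.mem_pairSpan_of_orthogonal (hL ▸ Submodule.mem_top) fun i hi => ?_
  have h := hp.apply_eq_zero hi hm hv
  rwa [← hΓ hgΓ v, ← hΓ hgΓ v (f i), (hfix i hi).1, (hfix i hi).2] at h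

omit hp in
theorem fixPairs_eq_bot (hL : pairSpan R e f 0 s = ⊤) : fixPairs Γ e f s = ⊥ := by
  rw [Subgroup.eq_bot_iff_forall]
  intro g hg
  refine LinearEquiv.toLinearMap_injective (LinearMap.ext_on hL ?_)
  rintro _ (⟨i, ⟨-, hi⟩, rfl⟩ | ⟨i, ⟨-, hi⟩, rfl⟩)
  exacts [((mem_fixPairs.mp hg).2 i hi).1, ((mem_fixPairs.mp hg).2 i hi).2]

/-- The splitting `v = a e_m + b f_m + y` of the span of the pairs from the `m`-th one on. -/
noncomputable def pairSpanSuccEquiv (hm : m < s) :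
    ((R × R) × pairSpan R e f (m + 1) s) ≃ pairSpan R e f m s :=
  Equiv.ofBijective
    (fun z => ⟨z.1.1 • e m + z.1.2 • f m + z.2, add_mem (add_mem
      (Submodule.smul_mem _ _ (left_mem_pairSpan le_rfl hm))
      (Submodule.smul_mem _ _ (right_mem_pairSpan le_rfl hm)))
      (pairSpan_anti m.le_succ z.2.2)⟩) <| by
    constructor
    · rintro ⟨⟨a, b⟩, y⟩ ⟨⟨a', b'⟩, y'⟩ h
      rw [Subtype.mk.injEq] at h
      have hy (z : pairSpan R e f (m + 1) s) := hp.apply_eq_zero m.lt_succ_self hm z.2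
      obtain rfl : a = a' := by
        simpa [hy, hp.ef m hm m hm, hp.isAlt (f m)] using congrArg (ω · (f m)) h
      obtain rfl : b = b' := by
        simpa [hy, hp.fe hm hm, hp.isAlt (e m)] using congrArg (ω · (e m)) h
      simpa using h
    · rintro ⟨v, hv⟩
      obtain ⟨y, hy, hvy⟩ := hp.exists_eq_smul_sub_smul_add hm hv
      exact ⟨((ω v (f m), -ω v (e m)), ⟨y, hy⟩), Subtype.ext (by
        simp only [neg_smul, ← sub_eq_add_neg]
        exact hvy.symm)⟩

theorem coe_pairSpanSuccEquiv (hm : m < s) (z : (R × R) × pairSpan R e f (m + 1) s) :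
    (hp.pairSpanSuccEquiv hm z : M) = z.1.1 • e m + z.1.2 • f m + z.2 := rfl

theorem apply_pairSpanSuccEquiv (hm : m < s) (z : (R × R) × pairSpan R e f (m + 1) s) :
    ω (e m) (hp.pairSpanSuccEquiv hm z) = z.1.2 := by
  have h := (hp.apply_eq_zero m.lt_succ_self hm z.2.2).1
  rw [coe_pairSpanSuccEquiv, apply_swap_eq_neg hp.isAlt]
  simp [h, hp.isAlt (e m), hp.fe hm hm]

theorem card_pairSpan {d : ℕ} (hd : m + d = s) :
    Nat.card (pairSpan R e f m s) = Nat.card R ^ (2 * d) := by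
  induction d generalizing m with
  | zero =>
    subst hd
    simp [pairSpan, pairSet]
  | succ d ih =>
    rw [← Nat.card_congr (hp.pairSpanSuccEquiv (by omega)), Nat.card_prod, Nat.card_prod,
      ih (by omega)]
    ring

theorem ncard_setOf_apply_eq_one {d : ℕ} (hd : m + d + 1 = s) :
    {v | v ∈ pairSpan R e f m s ∧ ω (e m) v = 1}.ncard = Nat.card R ^ (2 * d + 1) := by
  have hm : m < s := by omega
  have himage : {v | v ∈ pairSpan R e f m s ∧ ω (e m) v = 1} =
      Set.range fun z : R × pairSpan R e f (m + 1) s =>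
        (hp.pairSpanSuccEquiv hm ((z.1, 1), z.2) : M) := by
    ext v
    constructor
    · rintro ⟨hv, hev⟩
      obtain ⟨z, hz⟩ := (hp.pairSpanSuccEquiv hm).surjective ⟨v, hv⟩
      obtain rfl : (hp.pairSpanSuccEquiv hm z : M) = v := congrArg Subtype.val hz
      rw [hp.apply_pairSpanSuccEquiv] at hev
      exact ⟨(z.1.1, z.2), by simp only [← hev]⟩
    · rintro ⟨z, rfl⟩
      exact ⟨Subtype.coe_prop _, hp.apply_pairSpanSuccEquiv hm _⟩
  have hinj : Function.Injective fun z : R × pairSpan R e f (m + 1) s =>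
      (hp.pairSpanSuccEquiv hm ((z.1, 1), z.2) : M) := fun z z' h => by
    simpa [Prod.ext_iff] using (hp.pairSpanSuccEquiv hm).injective (Subtype.val_injective h)
  rw [himage, Set.ncard_range_of_injective hinj, Nat.card_prod,
    hp.card_pairSpan (d := d) (by omega)]
  ring

end IsHyperbolic

end FixPairs

section SymplecticOrder

variable {F V : Type*} [Field F] [AddCommGroup V] [Module F V] {ω : LinearMap.BilinForm F V}

theorem transv_sub_apply (hω : ω.IsAlt) {v w : V} (h : ω v w ≠ 0) :
    transv ω hω (w - v) (ω v w)⁻¹ v = w := by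
  rw [transv_apply, map_sub, hω v, sub_zero, inv_mul_cancel₀ h, one_smul, add_sub_cancel]

theorem exists_mem_apply_ne_zero_and {L : Submodule F V} {v w : V} (hv : ∃ a ∈ L, ω v a ≠ 0)
    (hw : ∃ a ∈ L, ω w a ≠ 0) : ∃ a ∈ L, ω v a ≠ 0 ∧ ω w a ≠ 0 := by
  obtain ⟨a, ha, hva⟩ := hv
  obtain ⟨b, hb, hwb⟩ := hw
  by_cases hwa : ω w a = 0
  · by_cases hvb : ω v b = 0
    · exact ⟨a + b, add_mem ha hb, by simpa [hvb], by simpa [hwa]⟩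
    · exact ⟨b, hb, hvb, hwb⟩
  · exact ⟨a, ha, hva, hwa⟩

namespace IsHyperbolic

variable {e f : ℕ → V} {s m : ℕ} {Γ : Subgroup (V ≃ₗ[F] V)} (hp : IsHyperbolic ω e f s)
include hp

theorem exists_mem_pairSpan_apply_ne_zero {v : V} (hv : v ∈ pairSpan F e f m s) (hv0 : v ≠ 0) :
    ∃ a ∈ pairSpan F e f m s, ω v a ≠ 0 := by
  by_contra! h
  refine hv0 ?_
  rw [hp.eq_sum hv]
  refine Finset.sum_eq_zero fun i hi => ?_
  obtain ⟨hm, hi⟩ := Finset.mem_Ico.mp hi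
  rw [h _ (left_mem_pairSpan hm hi), h _ (right_mem_pairSpan hm hi), zero_smul, zero_smul,
    sub_zero]

theorem orbit_fixPairs (hL : pairSpan F e f 0 s = ⊤) (hΓ : Γ ≤ isometries ω)
    (htransv : ∀ v c, transv ω hp.isAlt v c ∈ Γ) (hm : m < s) :
    MulAction.orbit (fixPairs Γ e f m) (e m) = (pairSpan F e f m s : Set V) \ {0} := by
  have he : e m ∈ pairSpan F e f m s := left_mem_pairSpan le_rfl hm
  have he0 : e m ≠ 0 := fun h => by simpa [h] using hp.ef m hm m hm
  ext v
  constructor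
  · rintro ⟨g, rfl⟩
    exact ⟨hp.apply_mem_of_mem_fixPairs hL hΓ hm.le g.2 he, (LinearEquiv.map_ne_zero_iff _).mpr he0⟩
  · rintro ⟨hv, hv0⟩
    obtain ⟨a, ha, hea, hva⟩ := exists_mem_apply_ne_zero_and
      (hp.exists_mem_pairSpan_apply_ne_zero he he0) (hp.exists_mem_pairSpan_apply_ne_zero hv hv0)
    have hav : ω a v ≠ 0 := by rwa [apply_swap_eq_neg hp.isAlt v, neg_ne_zero]
    exact ⟨⟨_, mul_mem (hp.transv_mem_fixPairs htransv hm.le (sub_mem hv ha) (ω a v)⁻¹)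
      (hp.transv_mem_fixPairs htransv hm.le (sub_mem ha he) (ω (e m) a)⁻¹)⟩,
      (congrArg (transv ω hp.isAlt (v - a) (ω a v)⁻¹) (transv_sub_apply hp.isAlt hea)).trans
        (transv_sub_apply hp.isAlt hav)⟩

theorem orbit_fixPairs_inf_stabilizer (hL : pairSpan F e f 0 s = ⊤) (hΓ : Γ ≤ isometries ω)
    (htransv : ∀ v c, transv ω hp.isAlt v c ∈ Γ) (hm : m < s) :
    MulAction.orbit ↥(fixPairs Γ e f m ⊓ MulAction.stabilizer (V ≃ₗ[F] V) (e m)) (f m) =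
      {v | v ∈ pairSpan F e f m s ∧ ω (e m) v = 1} := by
  have he : e m ∈ pairSpan F e f m s := left_mem_pairSpan le_rfl hm
  have hf : f m ∈ pairSpan F e f m s := right_mem_pairSpan le_rfl hm
  have hef : ω (e m) (f m) = 1 := by rw [hp.ef m hm m hm, if_pos rfl]
  ext v
  constructor
  · rintro ⟨⟨g, hg, hge⟩, rfl⟩
    refine ⟨hp.apply_mem_of_mem_fixPairs hL hΓ hm.le hg hf, ?_⟩
    have h := hΓ (mem_fixPairs.mp hg).1 (e m) (f m)
    rwa [show g (e m) = e m from hge, hef] at h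
  · rintro ⟨hv, hev⟩
    have exists_apply {x y : V} (hx : x ∈ pairSpan F e f m s) (hy : y ∈ pairSpan F e f m s)
        (hex : ω (e m) x = 1) (hey : ω (e m) y = 1) (hxy : ω x y ≠ 0) :
        ∃ g ∈ fixPairs Γ e f m ⊓ MulAction.stabilizer (V ≃ₗ[F] V) (e m), g x = y :=
      ⟨_, ⟨hp.transv_mem_fixPairs htransv hm.le (sub_mem hy hx) _,
        transv_apply_of_eq_zero _ (by rw [map_sub, hex, hey, sub_self]) _⟩,
        transv_sub_apply hp.isAlt hxy⟩
    by_cases hfv : ω (f m) v = 0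
    · have heef : ω (e m) (e m + f m) = 1 := by rw [map_add, hp.isAlt, hef, zero_add]
      obtain ⟨g, hg, hgf⟩ := exists_apply hf (add_mem he hf) hef heef
        (by simp [hp.isAlt (f m), hp.fe hm hm])
      obtain ⟨h, hh, hhv⟩ := exists_apply (add_mem he hf) hv heef hev (by simp [hfv, hev])
      exact ⟨⟨h * g, mul_mem hh hg⟩, (congrArg h hgf).trans hhv⟩
    · obtain ⟨g, hg, hgv⟩ := exists_apply hf hv hef hev hfv
      exact ⟨⟨g, hg⟩, hgv⟩

theorem card_fixPairs (hL : pairSpan F e f 0 s = ⊤) (hΓ : Γ ≤ isometries ω)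
    (htransv : ∀ v c, transv ω hp.isAlt v c ∈ Γ) {d : ℕ} (hd : m + d = s) :
    Nat.card (fixPairs Γ e f m) =
      ∏ k ∈ Finset.Icc 1 d, ((Nat.card F ^ (2 * k) - 1) * Nat.card F ^ (2 * k - 1)) := by
  induction d generalizing m with
  | zero =>
    obtain rfl : m = s := hd
    simp [fixPairs_eq_bot hL]
  | succ d ih =>
    have hm : m < s := by omega
    rw [← ncard_orbit_mul_card_inf_stabilizer _ (e m), ← ncard_orbit_mul_card_inf_stabilizer
      (fixPairs Γ e f m ⊓ _) (f m), ← fixPairs_succ, ih (by omega),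
      hp.orbit_fixPairs hL hΓ htransv hm, hp.orbit_fixPairs_inf_stabilizer hL hΓ htransv hm,
      Set.ncard_sdiff_singleton_of_mem (zero_mem _),
      hp.ncard_setOf_apply_eq_one (d := d) (by omega), ← Nat.card_coe_set_eq,
      SetLike.coe_sort_coe, hp.card_pairSpan hd, Finset.prod_Icc_succ_top (by omega),
      show 2 * (d + 1) - 1 = 2 * d + 1 by omega]
    ring

theorem card_eq_prod (hL : pairSpan F e f 0 s = ⊤) (hΓ : Γ ≤ isometries ω)
    (htransv : ∀ v c, transv ω hp.isAlt v c ∈ Γ) :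
    Nat.card Γ =
      ∏ k ∈ Finset.Icc 1 s, ((Nat.card F ^ (2 * k) - 1) * Nat.card F ^ (2 * k - 1)) := by
  rw [← hp.card_fixPairs hL hΓ htransv (zero_add s), fixPairs_zero]

end IsHyperbolic

end SymplecticOrder

section Matrices

variable {ι : Type*} [Fintype ι] [DecidableEq ι]

/-- Invertible matrices as linear automorphisms of the module of column vectors. -/
def glEquiv (R : Type*) [CommRing R] (ι : Type*) [Fintype ι] [DecidableEq ι] :
    GL ι R ≃* ((ι → R) ≃ₗ[R] (ι → R)) :=
  Matrix.GeneralLinearGroup.toLin.trans (LinearMap.GeneralLinearGroup.generalLinearEquiv R (ι → R))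

theorem glEquiv_apply {R : Type*} [CommRing R] (A : GL ι R) (v : ι → R) :
    glEquiv R ι A v = (A : Matrix ι ι R) *ᵥ v := rfl

theorem glEquiv_map_intCast {R : Type*} [CommRing R] (A : GL ι ℤ) (v : ι → ℤ) :
    glEquiv R ι (Matrix.GeneralLinearGroup.map (Int.castRingHom R) A) (Int.cast ∘ v) =
      Int.cast ∘ glEquiv ℤ ι A v :=
  (funext ((Int.castRingHom R).map_mulVec _ v)).symm

omit [Fintype ι] [DecidableEq ι] in
theorem exists_eq_add_two_smul_iff {v w : ι → ℤ} :
    (∃ x, w = v + (2 : ℤ) • x) ↔ (Int.cast ∘ w : ι → ZMod 2) = Int.cast ∘ v := by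
  constructor
  · rintro ⟨x, rfl⟩
    ext i
    simpa using Or.inl CharTwo.two_eq_zero
  · intro h
    have hdvd (i) : ∃ x, w i - v i = 2 * x :=
      (ZMod.intCast_eq_intCast_iff_dvd_sub _ _ 2).mp (congrFun h i).symm
    choose x hx using hdvd
    exact ⟨x, funext fun i => eq_add_of_sub_eq' (hx i)⟩

end Matrices

section ReductionModTwo

variable {n : ℕ} {ι : Type} [Fintype ι] [DecidableEq ι]

theorem mod2_eq_one_iff {A : GL ι ℤ} :
    mod2 ι A = 1 ↔ ∀ v, ∃ w, glEquiv ℤ ι A v = v + (2 : ℤ) • w := by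
  simp only [exists_eq_add_two_smul_iff, ← glEquiv_map_intCast]
  refine ⟨fun h v => ?_, fun h => (glEquiv (ZMod 2) ι).injective (LinearEquiv.ext fun v => ?_)⟩
  · change glEquiv _ _ (mod2 ι A) _ = _
    rw [h, map_one, LinearEquiv.coe_one, id]
  · obtain ⟨w, rfl⟩ := (ZMod.intCast_surjective (n := 2)).comp_left v
    rw [map_one]
    exact h w

theorem glEquiv_rhoMatrix (c : (Fin n → ℤ) ≃ₗ[ℤ] (ι → ℤ)) (b : BraidGroup n) (v : ι → ℤ) :
    glEquiv ℤ ι (rhoMatrix c b) v = c (rho n b (c.symm v)) := by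
  change LinearMap.GeneralLinearGroup.generalLinearEquiv ℤ (ι → ℤ)
    (Matrix.GeneralLinearGroup.toLin (Matrix.GeneralLinearGroup.toLin.symm _)) v = _
  rw [MulEquiv.apply_symm_apply]
  rfl

theorem mod2_rhoMatrix_eq_one_iff (c : (Fin n → ℤ) ≃ₗ[ℤ] (ι → ℤ)) (b : BraidGroup n) :
    mod2 ι (rhoMatrix c b) = 1 ↔ ∀ k, (Int.cast ∘ rho n b k : Fin n → ZMod 2) = Int.cast ∘ k := by
  simp only [mod2_eq_one_iff, glEquiv_rhoMatrix, ← exists_eq_add_two_smul_iff]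
  refine ⟨fun h k => ?_, fun h v => ?_⟩
  · obtain ⟨w, hw⟩ := h (c k)
    refine ⟨c.symm w, c.injective ?_⟩
    rw [map_add, map_smul, c.apply_symm_apply, ← hw, c.symm_apply_apply]
  · obtain ⟨w, hw⟩ := h (c.symm v)
    exact ⟨c w, by rw [hw, map_add, map_smul, c.apply_symm_apply]⟩

theorem rho_of (i : Fin n) : rho n (PresentedGroup.of i) = sigma i :=
  PresentedGroup.toGroup.of _

theorem swap_mul_swap_mul_swap_braid {α : Type*} [DecidableEq α] {a b c : α} (hab : a ≠ b)
    (hbc : b ≠ c) (hac : a ≠ c) : Equiv.swap a b * Equiv.swap b c * Equiv.swap a b =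
      Equiv.swap b c * Equiv.swap a b * Equiv.swap b c := by
  rw [Equiv.swap_mul_swap_mul_swap hab hac, Equiv.swap_comm a b, Equiv.swap_comm b c,
    Equiv.swap_mul_swap_mul_swap hbc.symm hac.symm, Equiv.swap_comm]

/-- The permutation of the strands of a braid. -/
def braidPerm (n : ℕ) : BraidGroup n →* Equiv.Perm (Fin (n + 1)) :=
  PresentedGroup.toGroup (f := fun i => Equiv.swap i.castSucc i.succ) <| by
    rintro r (⟨i, j, h⟩ | ⟨i, j, h⟩) <;>
      simp only [map_mul, map_inv, FreeGroup.lift_apply_of, mul_inv_eq_one]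
    · rw [show j.castSucc = i.succ from Fin.ext h.symm]
      apply swap_mul_swap_mul_swap_braid <;> simp [Fin.ext_iff] <;> omega
    · refine (Equiv.Perm.Disjoint.commute (Equiv.Perm.disjoint_swap_swap ?_)).eq
      simp [Fin.ext_iff]; omega

theorem braidPerm_of (i : Fin n) :
    braidPerm n (PresentedGroup.of i) = Equiv.swap i.castSucc i.succ :=
  PresentedGroup.toGroup.of _

theorem braidPerm_surjective (n : ℕ) : Function.Surjective (braidPerm n) := by
  rw [← MonoidHom.range_eq_top, eq_top_iff,
    ← Subgroup.closure_eq_top_of_mclosure_eq_top (Equiv.Perm.mclosure_swap_castSucc_succ n),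
    Subgroup.closure_le]
  rintro _ ⟨i, rfl⟩
  exact ⟨_, braidPerm_of i⟩

/-- A labelling `w` of the strands by residues modulo 2 is encoded by the vectors `k` whose
entries are congruent to the differences between the labels of the other strands and that of the
first one; the braids act on labellings by permuting the strands. -/
def IsDiff (k : Fin n → ℤ) (w : Fin (n + 1) → ZMod 2) : Prop :=
  ∀ j, (k j : ZMod 2) = w j.succ - w 0

theorem exists_isDiff_left (k : Fin n → ℤ) : ∃ w, IsDiff k w :=
  ⟨Fin.cons 0 (Int.cast ∘ k), fun j => by simp⟩

theorem exists_isDiff_right (w : Fin (n + 1) → ZMod 2) : ∃ k : Fin n → ℤ, IsDiff k w :=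
  (ZMod.intCast_surjective (n := 2)).comp_left (fun j : Fin n => w j.succ - w 0) |>.imp
    fun _ => congrFun

theorem IsDiff.intCast_comp_eq {k l : Fin n → ℤ} {w : Fin (n + 1) → ZMod 2} (hk : IsDiff k w)
    (hl : IsDiff l w) : (Int.cast ∘ k : Fin n → ZMod 2) = Int.cast ∘ l :=
  funext fun j => (hk j).trans (hl j).symm

theorem IsDiff.congr_left {k l : Fin n → ℤ} {w : Fin (n + 1) → ZMod 2} (hk : IsDiff k w)
    (hkl : (Int.cast ∘ k : Fin n → ZMod 2) = Int.cast ∘ l) : IsDiff l w := fun j =>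
  (congrFun hkl j).symm.trans (hk j)

theorem IsDiff.eq_add {k : Fin n → ℤ} {w w' : Fin (n + 1) → ZMod 2} (h : IsDiff k w)
    (h' : IsDiff k w') (x : Fin (n + 1)) : w' x = w x + (w' 0 - w 0) := by
  cases x using Fin.cases with
  | zero => ring
  | succ j => linear_combination h j - h' j

theorem IsDiff.sigma {k : Fin n → ℤ} {w : Fin (n + 1) → ZMod 2} (h : IsDiff k w) (i : Fin n) :
    IsDiff (BraidSymplectic.sigma i k) (w ∘ Equiv.swap i.castSucc i.succ) := by
  intro j
  have two : (2 : ZMod 2) = 0 := CharTwo.two_eq_zero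
  have succ_ne {j j' : Fin n} (hj : j ≠ j') : j.succ ≠ j'.succ := (Fin.succ_injective n).ne hj
  rw [sigma_apply, Function.comp_apply, Function.comp_apply, sigmaFun]
  by_cases h0 : (i : ℕ) = 0
  · have hi0 : i.castSucc = 0 := Fin.ext h0
    rw [if_pos h0, hi0, Equiv.swap_apply_left]
    split_ifs with hji
    · rw [hji, Equiv.swap_apply_right, h i]
      linear_combination (w i.succ - w 0) * two
    · rw [Equiv.swap_apply_of_ne_of_ne j.succ_ne_zero (succ_ne hji), Int.cast_add, h i, h j]
      linear_combination (w i.succ - w 0) * two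
  · have hs0 : Equiv.swap i.castSucc i.succ 0 = 0 :=
      Equiv.swap_apply_of_ne_of_ne (fun h => h0 (congrArg Fin.val h).symm) i.succ_ne_zero.symm
    have hpred : (⟨i - 1, by omega⟩ : Fin n).succ = i.castSucc :=
      Fin.ext (Nat.sub_add_cancel (Nat.pos_of_ne_zero h0))
    rw [if_neg h0, hs0]
    split_ifs with hji hji'
    · rw [hji, Equiv.swap_apply_right, h, hpred]
    · rw [show j.succ = i.castSucc from Fin.ext hji', Equiv.swap_apply_left]
      push_cast
      rw [h i]
      linear_combination (k j + w 0 - w i.succ) * two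
    · rw [Equiv.swap_apply_of_ne_of_ne (fun h => hji' (congrArg Fin.val h)) (succ_ne hji), h j]

theorem IsDiff.sigma_symm {k : Fin n → ℤ} {w : Fin (n + 1) → ZMod 2} (h : IsDiff k w)
    (i : Fin n) :
    IsDiff ((BraidSymplectic.sigma i).symm k) (w ∘ Equiv.swap i.castSucc i.succ) := by
  obtain ⟨w', hw'⟩ := exists_isDiff_left ((BraidSymplectic.sigma i).symm k)
  have hsq := (hw'.sigma i).sigma i
  rw [LinearEquiv.apply_symm_apply, Function.comp_assoc, ← Equiv.Perm.coe_mul,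
    Equiv.swap_mul_self, Equiv.Perm.coe_one, Function.comp_id] at hsq
  exact (h.sigma i).congr_left (hsq.intCast_comp_eq hw')

theorem IsDiff.rho {k : Fin n → ℤ} {w : Fin (n + 1) → ZMod 2} (h : IsDiff k w)
    (b : BraidGroup n) : IsDiff (BraidSymplectic.rho n b k) (w ∘ ⇑(braidPerm n b)⁻¹) := by
  have hb : b ∈ Subgroup.closure (Set.range PresentedGroup.of) :=
    PresentedGroup.closure_range_of (BraidRel n) ▸ Subgroup.mem_top b
  induction hb using Subgroup.closure_induction_left generalizing k w with
  | one => simpa using h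
  | mul_left _ hx y _ ih =>
    obtain ⟨i, rfl⟩ := hx
    simpa [rho_of, braidPerm_of, Function.comp_assoc] using (ih h).sigma i
  | inv_mul_cancel _ hx y _ ih =>
    obtain ⟨i, rfl⟩ := hx
    simpa [rho_of, braidPerm_of, Function.comp_assoc] using (ih h).sigma_symm i

theorem perm_eq_one_of_forall_exists_add {α : Type*} [Fintype α] {R : Type*}
    [AddMonoidWithOne R] [NeZero (1 : R)] (hα : 2 < Fintype.card α) {π : Equiv.Perm α}
    (h : ∀ w : α → R, ∃ c, ∀ x, w (π x) = w x + c) : π = 1 := by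
  classical
  by_contra! hπ
  obtain ⟨a, ha⟩ := DFunLike.ne_iff.mp hπ
  obtain ⟨x, hx⟩ : ∃ x, x ∉ ({a, π a} : Finset α) := by
    by_contra! hall
    exact absurd (Finset.card_le_two (a := a) (b := π a))
      (by rwa [Finset.eq_univ_of_forall hall, not_le])
  obtain ⟨hxa, hxπ⟩ : x ≠ a ∧ x ≠ π a := by simpa using hx
  obtain ⟨c, hc⟩ := h (Pi.single (π a) 1)
  have hc0 : c = 0 := by simpa [hxa, hxπ] using (hc x).symm
  have ha' : a ≠ π a := fun h => ha h.symm
  simpa [hc0, ha'] using hc a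

theorem mod2_rhoMatrix_eq_one_iff_braidPerm (hn : 2 ≤ n) (c : (Fin n → ℤ) ≃ₗ[ℤ] (ι → ℤ))
    (b : BraidGroup n) : mod2 ι (rhoMatrix c b) = 1 ↔ braidPerm n b = 1 := by
  rw [mod2_rhoMatrix_eq_one_iff]
  constructor
  · intro h
    refine inv_eq_one.mp (perm_eq_one_of_forall_exists_add (R := ZMod 2) (by simpa using hn)
      fun w => ?_)
    obtain ⟨k, hk⟩ := exists_isDiff_right w
    exact ⟨_, hk.eq_add ((hk.rho b).congr_left (h k))⟩
  · intro h k
    obtain ⟨w, hw⟩ := exists_isDiff_left k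
    have hb := hw.rho b
    rw [h, inv_one, Equiv.Perm.coe_one, Function.comp_id] at hb
    exact hb.intCast_comp_eq hw

theorem exists_mulEquiv_of_ker_eq {B G P : Type*} [Group B] [Group G] [Group P] {f : B →* G}
    {p : B →* P} (hp : Function.Surjective p) (h : f.ker = p.ker) :
    ∃ e : f.range ≃* P, ∀ b, e ⟨f b, b, rfl⟩ = p b := by
  refine ⟨(QuotientGroup.quotientKerEquivRange f).symm.trans
    ((QuotientGroup.quotientMulEquivOfEq h).trans
      (QuotientGroup.quotientKerEquivOfSurjective p hp)), fun b => ?_⟩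
  have hb : (QuotientGroup.quotientKerEquivRange f).symm ⟨f b, b, rfl⟩ = (b : B ⧸ f.ker) :=
    (MulEquiv.symm_apply_eq _).mpr rfl
  rw [MulEquiv.trans_apply, hb]
  rfl

end ReductionModTwo

section SymplecticForm

variable {R : Type*} [CommRing R] {s : ℕ}

/-- The standard symplectic form `∑ (q_i p_i' - p_i q_i')`; Mathlib's matrix `J` is minus its Gram
matrix. -/
def omega (R : Type*) [CommRing R] (s : ℕ) : LinearMap.BilinForm R (Fin s ⊕ Fin s → R) :=
  Matrix.toBilin' (-J (Fin s) R)

theorem omega_apply (x y : Fin s ⊕ Fin s → R) :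
    omega R s x y = ∑ i, (x (Sum.inl i) * y (Sum.inr i) - x (Sum.inr i) * y (Sum.inl i)) := by
  rw [omega, Matrix.toBilin'_apply', neg_mulVec, J, fromBlocks_mulVec, dotProduct_neg]
  simp only [dotProduct, Fintype.sum_sum_type, Finset.sum_sub_distrib, Sum.elim_inl, Sum.elim_inr]
  simp [neg_mulVec]
  ring

theorem omega_isAlt : (omega R s).IsAlt := fun x => by
  rw [omega_apply]
  exact Finset.sum_eq_zero fun i _ => by ring

theorem mem_symplecticGroup_iff {A : GL (Fin s ⊕ Fin s) R} :
    (A : Matrix (Fin s ⊕ Fin s) (Fin s ⊕ Fin s) R) ∈ symplecticGroup (Fin s) R ↔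
      glEquiv R _ A ∈ isometries (omega R s) := by
  have hcomp : ∀ x y, Matrix.toBilin' (A.1ᵀ * -J (Fin s) R * A.1) x y =
      omega R s (glEquiv R _ A x) (glEquiv R _ A y) := fun x y => by
    rw [← Matrix.toBilin'_comp]
    rfl
  rw [SymplecticGroup.mem_iff', ← neg_inj, ← neg_mul, ← mul_neg, ← Matrix.toBilin'.injective.eq_iff,
    mem_isometries, LinearMap.ext_iff₂]
  simp only [hcomp]
  rfl

theorem mem_Sp_iff {A : GL (Fin s ⊕ Fin s) ℤ} :
    A ∈ Sp s ↔ glEquiv ℤ _ A ∈ isometries (omega ℤ s) :=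
  mem_symplecticGroup_iff

/-- The basis vector with coordinate `q_{t+1} = 1`; zero for `t ≥ s`. -/
def qVec (R : Type*) [CommRing R] (s t : ℕ) : Fin s ⊕ Fin s → R :=
  Sum.elim (fun j => if (j : ℕ) = t then 1 else 0) 0

/-- The basis vector with coordinate `p_{t+1} = 1`; zero for `t ≥ s`. -/
def pVec (R : Type*) [CommRing R] (s t : ℕ) : Fin s ⊕ Fin s → R :=
  Sum.elim 0 (fun j => if (j : ℕ) = t then 1 else 0)

theorem omega_qVec (v : Fin s ⊕ Fin s → R) (t : Fin s) :
    omega R s v (qVec R s t) = -v (Sum.inr t) := by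
  simp [omega_apply, qVec, Fin.val_inj]

theorem omega_pVec (v : Fin s ⊕ Fin s → R) (t : Fin s) :
    omega R s v (pVec R s t) = v (Sum.inl t) := by
  simp [omega_apply, pVec, Fin.val_inj]

theorem isHyperbolic_qVec_pVec : IsHyperbolic (omega R s) (qVec R s) (pVec R s) s where
  isAlt := omega_isAlt
  ef i _ j hj := by
    rw [omega_pVec _ ⟨j, hj⟩]
    simp [qVec, eq_comm]
  ee i _ j hj := by
    rw [omega_qVec _ ⟨j, hj⟩]
    simp [qVec]
  ff i _ j hj := by
    rw [omega_pVec _ ⟨j, hj⟩]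
    simp [pVec]

theorem pairSpan_qVec_pVec : pairSpan R (qVec R s) (pVec R s) 0 s = ⊤ := by
  refine top_unique fun v _ => ?_
  have hv : v = ∑ t : Fin s, (v (Sum.inl t) • qVec R s t + v (Sum.inr t) • pVec R s t) := by
    funext i
    rcases i with i | i <;> simp [qVec, pVec, Finset.sum_apply, Fin.val_inj]
  rw [hv]
  exact sum_mem fun t _ => add_mem
    (Submodule.smul_mem _ _ (left_mem_pairSpan (Nat.zero_le _) t.2))
    (Submodule.smul_mem _ _ (right_mem_pairSpan (Nat.zero_le _) t.2))

end SymplecticForm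

section BraidChain

variable {s : ℕ}

/-- The coordinates `(q, p)` of a sequence `X`, whose entry `X j` stands for the paper's
`x_{j+1}`. -/
def qpMap (s : ℕ) : (ℕ → ℤ) →ₗ[ℤ] (Fin s ⊕ Fin s → ℤ) where
  toFun X := Sum.elim (fun t => X (2 * t) - X (2 * t + 2)) fun t => X (2 * t + 1)
  map_add' X Y := by
    ext (t | t)
    · simp [add_sub_add_comm]
    · simp
  map_smul' c X := by
    ext (t | t) <;> simp [mul_sub]

theorem qpMap_inl (X : ℕ → ℤ) (t : Fin s) : qpMap s X (Sum.inl t) = X (2 * t) - X (2 * t + 2) := rfl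

theorem qpMap_inr (X : ℕ → ℤ) (t : Fin s) : qpMap s X (Sum.inr t) = X (2 * t + 1) := rfl

theorem qpMap_congr {X Y : ℕ → ℤ} (h : ∀ j ≤ 2 * s, X j = Y j) : qpMap s X = qpMap s Y := by
  ext (t | t)
  · rw [qpMap_inl, qpMap_inl, h _ (by omega), h _ (by omega)]
  · rw [qpMap_inr, qpMap_inr, h _ (by omega)]

theorem omega_qpMap (X Y : ℕ → ℤ) :
    omega ℤ s (qpMap s X) (qpMap s Y) =
      ∑ j ∈ Finset.range (2 * s), (X j * Y (j + 1) - X (j + 1) * Y j) := by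
  simp only [omega_apply, qpMap_inl, qpMap_inr]
  rw [← Finset.sum_range fun t => (X (2 * t) - X (2 * t + 2)) * Y (2 * t + 1) -
    X (2 * t + 1) * (Y (2 * t) - Y (2 * t + 2))]
  induction s with
  | zero => rfl
  | succ s ih =>
    rw [Finset.sum_range_succ, ih, mul_add_one, Finset.sum_range_succ, Finset.sum_range_succ]
    ring

/-- The sequence of coordinates `x` of the vector along which `σ_{i+1}` acts as a transvection. -/
def chainX (i j : ℕ) : ℤ :=
  if i = 0 then (if j % 2 = 1 then -1 else 0) else if j + 1 = i then 1 else 0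

/-- The vector along which `σ_{i+1}` acts as a transvection, in the coordinates `(q, p)`. -/
def chainVec (s i : ℕ) : Fin s ⊕ Fin s → ℤ := qpMap s (chainX i)

theorem omega_qpMap_chainVec (X : ℕ → ℤ) {i : ℕ} (hi : i ≤ 2 * s) :
    omega ℤ s (qpMap s X) (chainVec s i) =
      (if i < 2 then 0 else X (i - 2)) - X i + if i = 0 then X (2 * s) else 0 := by
  rw [chainVec, omega_qpMap]
  rcases i with _ | i
  · clear hi
    induction s with
    | zero => simp
    | succ s ih =>
      rw [mul_add_one, Finset.sum_range_succ, Finset.sum_range_succ, ih]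
      simp [chainX, Nat.add_mod]
  · have hX : ∀ j, chainX (i + 1) j = if j = i then 1 else 0 := by simp [chainX]
    rw [Finset.sum_sub_distrib]
    simp only [hX, mul_ite, mul_one, mul_zero, Finset.sum_ite_eq', Finset.mem_range]
    rcases i with _ | i
    · simp [show 0 < s by omega]
    · simp [show i < 2 * s by omega, show i + 1 < 2 * s by omega]

theorem isFormChain_chainVec (s : ℕ) : IsFormChain (omega ℤ s) (chainVec s) (2 * s + 1) where
  isAlt := omega_isAlt
  adj i hi := by
    rw [chainVec, omega_qpMap_chainVec _ (by omega)]
    grind [chainX]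
  orth i j hij hj := by
    rw [chainVec, omega_qpMap_chainVec _ (by omega)]
    grind [chainX]

theorem chainVec_add_two (s t : ℕ) : chainVec s (2 * t + 2) = pVec ℤ s t := by
  ext (j | j)
  · simp only [chainVec, qpMap_inl, chainX, pVec, Sum.elim_inl, Pi.zero_apply]
    grind
  · simp only [chainVec, qpMap_inr, chainX, pVec, Sum.elim_inr]
    grind

theorem chainVec_one (s : ℕ) : chainVec s 1 = qVec ℤ s 0 := by
  ext (j | j)
  · simp [chainVec, qpMap_inl, chainX, qVec]
  · simp [chainVec, qpMap_inr, chainX, qVec]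

theorem chainVec_add_three (s t : ℕ) :
    chainVec s (2 * t + 3) = qVec ℤ s (t + 1) - qVec ℤ s t := by
  ext (j | j)
  · simp only [chainVec, qpMap_inl, chainX, qVec, Sum.elim_inl, Pi.sub_apply]
    grind
  · simp only [chainVec, qpMap_inr, chainX, qVec, Sum.elim_inr, Pi.sub_apply, Pi.zero_apply]
    grind

theorem chainE_chainVec (s : ℕ) : chainE (chainVec s) s = 0 := by
  have hsum : ∀ m j, (∑ k ∈ Finset.range (m + 1), chainX (2 * k)) j =
      if j % 2 = 1 ∧ 2 * m ≤ j then -1 else 0 := fun m j => by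
    induction m with
    | zero => simp [chainX]
    | succ m ih =>
      rw [Finset.sum_range_succ, Pi.add_apply, ih]
      grind [chainX]
  simp only [chainE, chainVec, ← map_sum]
  rw [← map_zero (qpMap s)]
  exact qpMap_congr fun j hj => by
    rw [hsum, if_neg (by omega), Pi.zero_apply]

theorem span_chainVec_add_one :
    Submodule.span ℤ ((fun i => chainVec s (i + 1)) '' Set.Iio (2 * s)) = ⊤ := by
  have hmem : ∀ i < 2 * s,
      chainVec s (i + 1) ∈ Submodule.span ℤ ((fun i => chainVec s (i + 1)) '' Set.Iio (2 * s)) :=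
    fun i hi => Submodule.subset_span ⟨i, hi, rfl⟩
  rw [← top_le_iff, ← pairSpan_qVec_pVec, pairSpan, Submodule.span_le]
  rintro _ (⟨t, ⟨-, ht⟩, rfl⟩ | ⟨t, ⟨-, ht⟩, rfl⟩)
  · induction t with
    | zero => exact chainVec_one s ▸ hmem 0 (by omega)
    | succ t ih =>
      have hdiff := hmem (2 * t + 2) (by omega)
      rw [chainVec_add_three] at hdiff
      exact (Submodule.sub_mem_iff_left _ (ih (by omega))).1 hdiff
  · exact chainVec_add_two s t ▸ hmem (2 * t + 1) (by omega)

theorem span_chainVec : Submodule.span ℤ (chainVec s '' Set.Iio (2 * s)) = ⊤ := by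
  have hmem : ∀ i < 2 * s, chainVec s i ∈ Submodule.span ℤ (chainVec s '' Set.Iio (2 * s)) :=
    fun i hi => Submodule.subset_span ⟨i, hi, rfl⟩
  rw [← top_le_iff, ← span_chainVec_add_one, Submodule.span_le]
  rintro _ ⟨i, hi, rfl⟩
  rcases (Nat.succ_le_of_lt (Set.mem_Iio.1 hi)).lt_or_eq with hlt | heq
  · exact hmem _ hlt
  · have hlast : chainVec s (i + 1) = -∑ k ∈ Finset.range s, chainVec s (2 * k) := by
      rw [eq_neg_iff_add_eq_zero, add_comm, ← chainE_chainVec s, chainE, Finset.sum_range_succ,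
        ← heq]
    change chainVec s (i + 1) ∈ _
    rw [hlast]
    exact neg_mem (sum_mem fun k hk => hmem _ (by have := Finset.mem_range.1 hk; omega))

end BraidChain

section Affine

variable {R ι : Type*} [CommRing R]

/-- The linear automorphism of `R^ι × R` which restricts to `v ↦ T v + y` on the affine hyperplane
where the last coordinate is `1`. -/
def affineEquiv (T : (ι → R) ≃ₗ[R] (ι → R)) (y : ι → R) :
    (ι ⊕ Unit → R) ≃ₗ[R] (ι ⊕ Unit → R) where
  toFun v := Sum.elim (T (v ∘ Sum.inl) + v (Sum.inr ()) • y) fun _ => v (Sum.inr ())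
  invFun v := Sum.elim (T.symm (v ∘ Sum.inl - v (Sum.inr ()) • y)) fun _ => v (Sum.inr ())
  map_add' v w := by
    have hadd : (v + w) ∘ Sum.inl = v ∘ (Sum.inl : ι → ι ⊕ Unit) + w ∘ Sum.inl := rfl
    ext (i | i)
    · simp only [hadd, map_add, Sum.elim_inl, Pi.add_apply, Pi.smul_apply, smul_eq_mul]
      ring
    · rfl
  map_smul' c v := by
    have hsmul : (c • v) ∘ Sum.inl = c • (v ∘ (Sum.inl : ι → ι ⊕ Unit)) := rfl
    ext (i | i)
    · simp [hsmul, mul_add, mul_assoc]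
    · rfl
  left_inv v := by ext (i | i) <;> simp
  right_inv v := by ext (i | i) <;> simp

theorem affineEquiv_apply (T : (ι → R) ≃ₗ[R] (ι → R)) (y : ι → R) (v : ι ⊕ Unit → R) :
    affineEquiv T y v =
      Sum.elim (T (v ∘ Sum.inl) + v (Sum.inr ()) • y) fun _ => v (Sum.inr ()) := rfl

theorem affineEquiv_injective2 : Function.Injective2 (affineEquiv (R := R) (ι := ι)) := by
  intro T T' y y' h
  have hlin (v) : T v = T' v := by
    simpa [affineEquiv_apply] using congrArg (fun g => g (Sum.elim v 0) ∘ Sum.inl) h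
  have htrans : y = y' := by
    simpa [affineEquiv_apply] using congrArg (fun g => g (Sum.elim 0 1) ∘ Sum.inl) h
  exact ⟨LinearEquiv.ext hlin, htrans⟩

theorem affineEquiv_mul (T T' : (ι → R) ≃ₗ[R] (ι → R)) (y y' : ι → R) :
    affineEquiv T y * affineEquiv T' y' = affineEquiv (T * T') (T y' + y) := by
  ext v (i | i)
  · simp only [LinearEquiv.mul_apply, affineEquiv_apply, Sum.elim_comp_inl, Sum.elim_inr,
      Sum.elim_inl, map_add, map_smul, smul_add, Pi.add_apply]
    ring
  · rfl

theorem affineEquiv_one_zero : affineEquiv (1 : (ι → R) ≃ₗ[R] (ι → R)) 0 = 1 := by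
  ext v (i | i) <;> simp [affineEquiv_apply]

/-- The inclusion of the linear group into the affine group. -/
def linearToAffine (R ι : Type*) [CommRing R] :
    ((ι → R) ≃ₗ[R] (ι → R)) →* ((ι ⊕ Unit → R) ≃ₗ[R] (ι ⊕ Unit → R)) where
  toFun T := affineEquiv T 0
  map_one' := affineEquiv_one_zero
  map_mul' T T' := by rw [affineEquiv_mul, map_zero, add_zero]

/-- The vectors `y` such that the subgroup `H` contains the translation by `y`. -/
def translations (H : Subgroup ((ι ⊕ Unit → R) ≃ₗ[R] (ι ⊕ Unit → R))) : AddSubgroup (ι → R) where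
  carrier := {y | affineEquiv 1 y ∈ H}
  zero_mem' := by
    change affineEquiv 1 0 ∈ H
    exact affineEquiv_one_zero (R := R) (ι := ι) ▸ one_mem H
  add_mem' {y z} hy hz := by
    change affineEquiv 1 (y + z) ∈ H
    have := H.mul_mem hz hy
    rwa [affineEquiv_mul, one_mul, LinearEquiv.coe_one, id] at this
  neg_mem' {y} hy := by
    change affineEquiv 1 (-y) ∈ H
    have hinv : affineEquiv 1 (-y) = (affineEquiv 1 y)⁻¹ := by
      rw [eq_inv_iff_mul_eq_one, affineEquiv_mul, one_mul, LinearEquiv.coe_one, id, add_neg_cancel,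
        affineEquiv_one_zero]
    exact hinv ▸ inv_mem hy

variable {H : Subgroup ((ι ⊕ Unit → R) ≃ₗ[R] (ι ⊕ Unit → R))} {T : (ι → R) ≃ₗ[R] (ι → R)}
  {y : ι → R}

theorem affineEquiv_mem_iff (hT : affineEquiv T 0 ∈ H) :
    affineEquiv T y ∈ H ↔ y ∈ translations H := by
  rw [show affineEquiv T y = affineEquiv 1 y * affineEquiv T 0 by
    rw [affineEquiv_mul, one_mul, map_zero, zero_add], H.mul_mem_cancel_right hT]
  rfl

theorem apply_mem_translations (hT : affineEquiv T 0 ∈ H) (hy : y ∈ translations H) :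
    T y ∈ translations H := by
  have := mul_mem hT hy
  rwa [affineEquiv_mul, mul_one, add_zero, affineEquiv_mem_iff hT] at this

/-- The affine transformations whose linear part lies in `Γ`. -/
def affineSubgroup (Γ : Subgroup ((ι → R) ≃ₗ[R] (ι → R))) :
    Subgroup ((ι ⊕ Unit → R) ≃ₗ[R] (ι ⊕ Unit → R)) where
  carrier := {g | ∃ T ∈ Γ, ∃ y, affineEquiv T y = g}
  mul_mem' := by
    rintro _ _ ⟨T, hT, y, rfl⟩ ⟨T', hT', y', rfl⟩
    exact ⟨T * T', mul_mem hT hT', T y' + y, (affineEquiv_mul T T' y y').symm⟩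
  one_mem' := ⟨1, one_mem Γ, 0, affineEquiv_one_zero⟩
  inv_mem' := by
    rintro _ ⟨T, hT, y, rfl⟩
    refine ⟨T⁻¹, inv_mem hT, -T⁻¹ y, ?_⟩
    rw [eq_inv_iff_mul_eq_one, affineEquiv_mul, inv_mul_cancel, add_neg_cancel,
      affineEquiv_one_zero]

theorem card_affineSubgroup [Fintype ι] (Γ : Subgroup ((ι → R) ≃ₗ[R] (ι → R))) :
    Nat.card (affineSubgroup Γ) = Nat.card Γ * Nat.card R ^ Fintype.card ι := by
  have hbij : Function.Bijective fun p : Γ × (ι → R) =>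
      (⟨affineEquiv p.1 p.2, p.1, p.1.2, p.2, rfl⟩ : affineSubgroup Γ) := by
    refine ⟨fun p q hpq => ?_, fun ⟨_, T, hT, y, h⟩ => ⟨⟨⟨T, hT⟩, y⟩, Subtype.ext h⟩⟩
    obtain ⟨hlin, htrans⟩ := affineEquiv_injective2 (congrArg Subtype.val hpq)
    exact Prod.ext (Subtype.ext hlin) htrans
  rw [← Nat.card_congr (Equiv.ofBijective _ hbij), Nat.card_prod, Nat.card_fun,
    Nat.card_eq_fintype_card (α := ι)]

end Affine

section AffineChain

variable {ι : Type*} {ω : LinearMap.BilinForm ℤ (ι → ℤ)} {a : ℕ → ι → ℤ} {s : ℕ}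
  {H : Subgroup ((ι ⊕ Unit → ℤ) ≃ₗ[ℤ] (ι ⊕ Unit → ℤ))}

theorem affineEquiv_congr_one {T : (ι → ℤ) ≃ₗ[ℤ] (ι → ℤ)} {y : ι → ℤ}
    (h : ∀ v, ∃ w, affineEquiv T y v = v + (2 : ℤ) • w) :
    (∀ v, ∃ w, T v = v + (2 : ℤ) • w) ∧ ∃ u, y = (2 : ℤ) • u := by
  refine ⟨fun v => ?_, ?_⟩
  · obtain ⟨w, hw⟩ := h (Sum.elim v 0)
    refine ⟨w ∘ Sum.inl, funext fun i => ?_⟩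
    simpa [affineEquiv_apply] using congrFun hw (Sum.inl i)
  · obtain ⟨w, hw⟩ := h (Sum.elim 0 1)
    refine ⟨w ∘ Sum.inl, funext fun i => ?_⟩
    simpa [affineEquiv_apply] using congrFun hw (Sum.inl i)

theorem two_smul_mem_translations (hω : ω.IsAlt) (hlin : affineEquiv (transv ω hω (a 0) 2) 0 ∈ H)
    (h : affineEquiv (transv ω hω (a 0) 1) (-a 0) ∈ H) : (2 : ℤ) • a 0 ∈ translations H := by
  have hsq := mul_mem h h
  rw [affineEquiv_mul, transv_mul, transv_apply_of_eq_zero hω (by simp [hω (a 0)]),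
    one_add_one_eq_two, affineEquiv_mem_iff hlin, ← neg_add, neg_mem_iff, ← two_smul ℤ] at hsq
  exact hsq

namespace IsFormChain

variable (hc : IsFormChain ω a (2 * s + 1))
  (hspan : Submodule.span ℤ ((fun i => a (i + 1)) '' Set.Iio (2 * s)) = ⊤)
  (hH : ∀ i < 2 * s, affineEquiv (transv ω hc.isAlt (a (i + 1)) 1) 0 ∈ H)
include hc hspan hH

theorem affineEquiv_zero_mem {T : (ι → ℤ) ≃ₗ[ℤ] (ι → ℤ)} (hT : T ∈ isometries ω)
    (hT2 : ∀ v, ∃ w, T v = v + (2 : ℤ) • w) : affineEquiv T 0 ∈ H :=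
  hc.shift.mem_of_forall_exists_eq_add_two_smul hspan (H := H.comap (linearToAffine ℤ ι)) hH hT hT2

theorem two_smul_apply_mem_translations
    (hH0 : affineEquiv (transv ω hc.isAlt (a 0) 1) (-a 0) ∈ H) {i : ℕ} (hi : i ≤ 2 * s) :
    (2 : ℤ) • a i ∈ translations H := by
  induction i with
  | zero =>
    refine two_smul_mem_translations hc.isAlt (hc.affineEquiv_zero_mem hspan hH
      (transv_mem_isometries hc.isAlt _ _) fun v => ⟨ω v (a 0) • a 0, ?_⟩) hH0
    rw [transv_apply, mul_smul]
  | succ i ih =>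
    have hmem := sub_mem (apply_mem_translations (hH i hi) (ih (by omega))) (ih (by omega))
    rwa [map_smul, transv_apply, hc.adj i (by omega), one_mul, one_smul, smul_add,
      add_sub_cancel_left] at hmem

theorem affineEquiv_two_smul_mem (hspan' : Submodule.span ℤ (a '' Set.Iio (2 * s)) = ⊤)
    (hH0 : affineEquiv (transv ω hc.isAlt (a 0) 1) (-a 0) ∈ H) {T : (ι → ℤ) ≃ₗ[ℤ] (ι → ℤ)}
    (hT : T ∈ isometries ω) (hT2 : ∀ v, ∃ w, T v = v + (2 : ℤ) • w) (y : ι → ℤ) :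
    affineEquiv T ((2 : ℤ) • y) ∈ H := by
  have hspan_le : Submodule.span ℤ (a '' Set.Iio (2 * s)) ≤
      (translations H).toIntSubmodule.comap (LinearMap.lsmul ℤ (ι → ℤ) 2) := by
    rw [Submodule.span_le]
    rintro _ ⟨i, hi, rfl⟩
    exact hc.two_smul_apply_mem_translations hspan hH hH0 (Set.mem_Iio.1 hi).le
  rw [affineEquiv_mem_iff (hc.affineEquiv_zero_mem hspan hH hT hT2)]
  exact hspan_le (hspan' ▸ Submodule.mem_top)

end IsFormChain

end AffineChain

theorem fromBlocks_mulVec_eq_affineEquiv {s : ℕ} (g : GL (Fin s ⊕ Fin s) ℤ)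
    (y : Fin s ⊕ Fin s → ℤ) (v : (Fin s ⊕ Fin s) ⊕ Unit → ℤ) :
    fromBlocks g.1 (replicateCol Unit y) 0 1 *ᵥ v = affineEquiv (glEquiv ℤ _ g) y v := by
  rw [affineEquiv_apply, fromBlocks_mulVec, glEquiv_apply]
  congr 1
  · ext i
    simp [mulVec, dotProduct, mul_comm]
  · ext i
    simp

theorem mem_SpAffine_iff {s : ℕ} {A : GL ((Fin s ⊕ Fin s) ⊕ Unit) ℤ} :
    A ∈ SpAffine s ↔ glEquiv ℤ _ A ∈ affineSubgroup (isometries (omega ℤ s)) := by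
  have hblocks (g : GL (Fin s ⊕ Fin s) ℤ) (y) :
      A.1 = fromBlocks g.1 (replicateCol Unit y) 0 1 ↔
        affineEquiv (glEquiv ℤ _ g) y = glEquiv ℤ _ A := by
    rw [← Matrix.mulVec_injective.eq_iff, funext_iff, LinearEquiv.ext_iff]
    simp only [fromBlocks_mulVec_eq_affineEquiv, glEquiv_apply, eq_comm]
  constructor
  · rintro ⟨g, hg, y, h⟩
    exact ⟨_, mem_Sp_iff.1 hg, y, (hblocks g y).1 h⟩
  · rintro ⟨T, hT, y, h⟩
    obtain ⟨g, rfl⟩ := (glEquiv ℤ (Fin s ⊕ Fin s)).surjective T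
    exact ⟨g, mem_Sp_iff.2 hT, y, (hblocks g y).2 h⟩

section Generators

variable {n s : ℕ}

theorem xCoords_symm_apply (x : Fin n → ℤ) (i : Fin n) :
    (xCoords n).symm x i = (if (i : ℕ) = 0 then 0 else ext0 x (i - 1)) + x i := rfl

theorem xCoords_sigma (i : Fin n) (k : Fin n → ℤ) (j : Fin n) :
    xCoords n (sigma i k) j = xCoords n k j +
      ((if (i : ℕ) < 2 then 0 else ext0 (xCoords n k) (i - 2)) - ext0 (xCoords n k) i) *
        chainX i j := by
  obtain ⟨x, rfl⟩ := (xCoords n).symm.surjective k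
  rw [LinearEquiv.apply_symm_apply]
  revert j
  rw [← funext_iff (g := fun j => x j + _), ← LinearEquiv.eq_symm_apply]
  ext j
  rw [sigma_apply, sigmaFun]
  simp only [xCoords_symm_apply, ext0, chainX]
  grind

theorem ext0_xCoords_sigma (i : Fin n) (k : Fin n → ℤ) {j : ℕ} (hj : j < n ∨ Even j) :
    ext0 (xCoords n (sigma i k)) j = ext0 (xCoords n k) j +
      ((if (i : ℕ) < 2 then 0 else ext0 (xCoords n k) (i - 2)) - ext0 (xCoords n k) i) *
        chainX i j := by
  by_cases hjn : j < n
  · have hext (x : Fin n → ℤ) : ext0 x j = x ⟨j, hjn⟩ := ext0_val x ⟨j, hjn⟩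
    rw [hext, hext]
    exact xCoords_sigma i k ⟨j, hjn⟩
  · have hext (x : Fin n → ℤ) : ext0 x j = 0 := dif_neg hjn
    have hchain : chainX i j = 0 := by grind [chainX]
    rw [hext, hext, hchain, mul_zero, zero_add]

theorem qpMap_ext0_xCoords_sigma (hn : 2 * s ≤ n) (hn' : n ≤ 2 * s + 1) (i : Fin n)
    (k : Fin n → ℤ) :
    qpMap s (ext0 (xCoords n (sigma i k))) =
      transv (omega ℤ s) omega_isAlt (chainVec s i) 1 (qpMap s (ext0 (xCoords n k))) -
        (if (i : ℕ) = 0 then ext0 (xCoords n k) (2 * s) else 0) • chainVec s i := by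
  rw [transv_apply, one_mul, omega_qpMap_chainVec _ (by omega), add_sub_assoc, ← sub_smul,
    add_sub_cancel_right, chainVec, ← map_smul, ← map_add]
  refine qpMap_congr fun j hj => ?_
  rw [ext0_xCoords_sigma i k (by grind)]
  rfl

theorem glEquiv_rhoEven_of (i : Fin (2 * s)) :
    glEquiv ℤ _ (rhoEven s (PresentedGroup.of i)) =
      transv (omega ℤ s) omega_isAlt (chainVec s i) 1 := by
  ext1 v
  obtain ⟨k, rfl⟩ := ((xCoords (2 * s)).trans (qpEven s)).surjective v
  rw [rhoEven, glEquiv_rhoMatrix, rho_of, LinearEquiv.symm_apply_apply]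
  have hlast : ext0 (xCoords (2 * s) k) (2 * s) = 0 := dif_neg (lt_irrefl _)
  refine (qpMap_ext0_xCoords_sigma le_rfl (by omega) i k).trans ?_
  rw [hlast, ite_self, zero_smul, sub_zero]
  rfl

theorem glEquiv_rhoOdd_of (i : Fin (2 * s + 1)) :
    glEquiv ℤ _ (rhoOdd s (PresentedGroup.of i)) =
      affineEquiv (transv (omega ℤ s) omega_isAlt (chainVec s i) 1)
        (if (i : ℕ) = 0 then -chainVec s 0 else 0) := by
  ext1 v
  obtain ⟨k, rfl⟩ := ((xCoords (2 * s + 1)).trans (qpOdd s)).surjective v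
  rw [rhoOdd, glEquiv_rhoMatrix, rho_of, LinearEquiv.symm_apply_apply, affineEquiv_apply]
  ext (j | j)
  · refine (congrFun (qpMap_ext0_xCoords_sigma (by omega) le_rfl i k) j).trans ?_
    rw [sub_eq_add_neg, ← neg_smul, Sum.elim_inl]
    refine (add_right_inj (transv (omega ℤ s) omega_isAlt (chainVec s i) 1
      (qpMap s (ext0 (xCoords (2 * s + 1) k))) j)).2 ?_
    change _ = ext0 (xCoords (2 * s + 1) k) (2 * s) * _
    split_ifs with hi <;> simp [hi]
  · change ext0 (xCoords (2 * s + 1) (sigma i k)) (2 * s) =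
      ext0 (xCoords (2 * s + 1) k) (2 * s)
    rw [ext0_xCoords_sigma (j := 2 * s) i k (by simp)]
    have hchain : chainX i (2 * s) = 0 := by grind [chainX]
    rw [hchain, mul_zero, add_zero]

end Generators

section LinearReductionModTwo

variable {ι : Type} [Fintype ι] [DecidableEq ι]

/-- Reduction modulo 2 of automorphisms of `ℤ^ι`: the coordinate-free form of `mod2`. -/
def mod2Equiv (ι : Type) [Fintype ι] [DecidableEq ι] :
    ((ι → ℤ) ≃ₗ[ℤ] (ι → ℤ)) →* ((ι → ZMod 2) ≃ₗ[ZMod 2] (ι → ZMod 2)) :=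
  (glEquiv (ZMod 2) ι).toMonoidHom.comp ((mod2 ι).comp (glEquiv ℤ ι).symm.toMonoidHom)

theorem mod2Equiv_apply (T : (ι → ℤ) ≃ₗ[ℤ] (ι → ℤ)) (v : ι → ℤ) :
    mod2Equiv ι T (Int.cast ∘ v) = Int.cast ∘ T v := by
  obtain ⟨A, rfl⟩ := (glEquiv ℤ ι).surjective T
  rw [← glEquiv_map_intCast]
  change glEquiv _ _ (mod2 ι ((glEquiv ℤ ι).symm _)) _ = _
  rw [MulEquiv.symm_apply_apply]
  rfl

theorem mod2Equiv_eq_iff {T : (ι → ℤ) ≃ₗ[ℤ] (ι → ℤ)}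
    {T' : (ι → ZMod 2) ≃ₗ[ZMod 2] (ι → ZMod 2)} :
    mod2Equiv ι T = T' ↔ ∀ v : ι → ℤ, Int.cast ∘ T v = T' (Int.cast ∘ v) := by
  simp only [← mod2Equiv_apply]
  refine ⟨fun h v => h ▸ rfl, fun h => LinearEquiv.ext fun v => ?_⟩
  obtain ⟨v, rfl⟩ := (ZMod.intCast_surjective (n := 2)).comp_left v
  exact h v

theorem card_map_mod2 {G : Subgroup (GL ι ℤ)} {K : Subgroup ((ι → ℤ) ≃ₗ[ℤ] (ι → ℤ))}
    (h : ∀ A, A ∈ G ↔ glEquiv ℤ ι A ∈ K) :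
    Nat.card (G.map (mod2 ι)) = Nat.card (K.map (mod2Equiv ι)) := by
  have hG : G = K.map (glEquiv ℤ ι).symm.toMonoidHom := by
    ext A
    rw [h, Subgroup.mem_map_equiv, MulEquiv.symm_symm]
  rw [mod2Equiv, ← Subgroup.map_map, ← Subgroup.map_map, ← hG]
  exact (Subgroup.card_map_of_injective (glEquiv (ZMod 2) ι).injective).symm

theorem mod2Equiv_affineEquiv (T : (ι → ℤ) ≃ₗ[ℤ] (ι → ℤ)) (y : ι → ℤ) :
    mod2Equiv (ι ⊕ Unit) (affineEquiv T y) = affineEquiv (mod2Equiv ι T) (Int.cast ∘ y) := by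
  refine mod2Equiv_eq_iff.2 fun v => ?_
  rw [affineEquiv_apply, affineEquiv_apply, Function.comp_assoc, mod2Equiv_apply]
  ext (i | i) <;> simp

theorem map_mod2Equiv_affineSubgroup (Γ : Subgroup ((ι → ℤ) ≃ₗ[ℤ] (ι → ℤ))) :
    (affineSubgroup Γ).map (mod2Equiv (ι ⊕ Unit)) = affineSubgroup (Γ.map (mod2Equiv ι)) := by
  ext g
  constructor
  · rintro ⟨_, ⟨T, hT, y, rfl⟩, rfl⟩
    exact ⟨_, ⟨T, hT, rfl⟩, _, (mod2Equiv_affineEquiv T y).symm⟩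
  · rintro ⟨_, ⟨T, hT, rfl⟩, y, rfl⟩
    obtain ⟨y, rfl⟩ := (ZMod.intCast_surjective (n := 2)).comp_left y
    exact ⟨_, ⟨T, hT, y, rfl⟩, mod2Equiv_affineEquiv T y⟩

variable {s : ℕ}

theorem omega_intCast {R : Type*} [CommRing R] (v w : Fin s ⊕ Fin s → ℤ) :
    omega R s (Int.cast ∘ v) (Int.cast ∘ w) = omega ℤ s v w := by
  simp [omega_apply]

theorem map_mod2Equiv_isometries_le :
    (isometries (omega ℤ s)).map (mod2Equiv _) ≤ isometries (omega (ZMod 2) s) := by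
  rintro _ ⟨T, hT, rfl⟩ v w
  obtain ⟨v, rfl⟩ := (ZMod.intCast_surjective (n := 2)).comp_left v
  obtain ⟨w, rfl⟩ := (ZMod.intCast_surjective (n := 2)).comp_left w
  rw [mod2Equiv_apply, mod2Equiv_apply, omega_intCast, omega_intCast, hT]

theorem transv_mem_map_mod2Equiv_isometries (v : Fin s ⊕ Fin s → ZMod 2) (c : ZMod 2) :
    transv (omega (ZMod 2) s) omega_isAlt v c ∈ (isometries (omega ℤ s)).map (mod2Equiv _) := by
  obtain ⟨v, rfl⟩ := (ZMod.intCast_surjective (n := 2)).comp_left v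
  obtain ⟨c, rfl⟩ := ZMod.intCast_surjective c
  refine ⟨_, transv_mem_isometries omega_isAlt v c, mod2Equiv_eq_iff.2 fun x => ?_⟩
  rw [transv_apply, transv_apply, omega_intCast]
  ext i
  simp

theorem card_map_mod2Equiv_isometries :
    Nat.card ((isometries (omega ℤ s)).map (mod2Equiv _)) =
      ∏ k ∈ Finset.Icc 1 s, ((2 ^ (2 * k) - 1) * 2 ^ (2 * k - 1)) := by
  simpa only [Nat.card_zmod] using isHyperbolic_qVec_pVec.card_eq_prod pairSpan_qVec_pVec
    map_mod2Equiv_isometries_le transv_mem_map_mod2Equiv_isometries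

theorem cast_prod_Icc_eq (s : ℕ) :
    ((∏ k ∈ Finset.Icc 1 s, ((2 ^ (2 * k) - 1) * 2 ^ (2 * k - 1)) : ℕ) : ℚ) =
      2 ^ (s ^ 2) * ∏ k ∈ Finset.Icc 1 s, ((2 : ℚ) ^ (2 * k) - 1) := by
  induction s with
  | zero => simp
  | succ s ih =>
    rw [Finset.prod_Icc_succ_top (by omega), Finset.prod_Icc_succ_top (by omega), Nat.cast_mul, ih,
      Nat.cast_mul, Nat.cast_sub Nat.one_le_two_pow, show 2 * (s + 1) - 1 = 2 * s + 1 by omega]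
    push_cast
    ring

theorem cast_card_map_Sp (s : ℕ) : (Nat.card ((Sp s).map (mod2 _)) : ℚ) =
    2 ^ (s ^ 2) * ∏ k ∈ Finset.Icc 1 s, ((2 : ℚ) ^ (2 * k) - 1) := by
  rw [card_map_mod2 fun _ => mem_Sp_iff, card_map_mod2Equiv_isometries, cast_prod_Icc_eq]

theorem cast_card_map_SpAffine (s : ℕ) : (Nat.card ((SpAffine s).map (mod2 _)) : ℚ) =
    2 ^ (s ^ 2 + 2 * s) * ∏ k ∈ Finset.Icc 1 s, ((2 : ℚ) ^ (2 * k) - 1) := by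
  rw [card_map_mod2 fun _ => mem_SpAffine_iff, map_mod2Equiv_affineSubgroup, card_affineSubgroup,
    card_map_mod2Equiv_isometries, Nat.cast_mul, cast_prod_Icc_eq, Nat.card_zmod,
    Fintype.card_sum, Fintype.card_fin]
  push_cast
  ring

end LinearReductionModTwo

theorem range_le_of_generators {n : ℕ} {G : Type*} [Group G] {f : BraidGroup n →* G}
    {K : Subgroup G} (h : ∀ i, f (PresentedGroup.of i) ∈ K) : f.range ≤ K := by
  rw [MonoidHom.range_eq_map, ← PresentedGroup.closure_range_of, MonoidHom.map_closure,
    Subgroup.closure_le]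
  rintro _ ⟨_, ⟨i, rfl⟩, rfl⟩
  exact h i

section Image

variable (s : ℕ)

theorem range_rhoEven_le : (rhoEven s).range ≤ Sp s :=
  range_le_of_generators fun i => by
    rw [mem_Sp_iff, glEquiv_rhoEven_of]
    exact transv_mem_isometries _ _ _

theorem range_rhoOdd_le : (rhoOdd s).range ≤ SpAffine s :=
  range_le_of_generators fun i => by
    rw [mem_SpAffine_iff, glEquiv_rhoOdd_of]
    exact ⟨_, transv_mem_isometries _ _ _, _, rfl⟩

theorem principalCongruence_Sp_le : principalCongruence (Sp s) ≤ (rhoEven s).range := by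
  rintro A ⟨hA, hA2⟩
  have hmem := ((isFormChain_chainVec s).mono (Nat.le_succ _)).mem_of_forall_exists_eq_add_two_smul
    (H := (rhoEven s).range.map (glEquiv ℤ _).toMonoidHom) span_chainVec
    (fun i hi => ⟨_, ⟨_, rfl⟩, glEquiv_rhoEven_of ⟨i, hi⟩⟩) (mem_Sp_iff.1 hA)
    (mod2_eq_one_iff.1 hA2)
  exact (Subgroup.mem_map_iff_mem (glEquiv ℤ _).injective).1 hmem

theorem principalCongruence_SpAffine_le :
    principalCongruence (SpAffine s) ≤ (rhoOdd s).range := by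
  rintro A ⟨hA, hA2⟩
  obtain ⟨T, hT, y, hTy⟩ := mem_SpAffine_iff.1 hA
  obtain ⟨hT2, u, rfl⟩ := affineEquiv_congr_one (y := y) (hTy ▸ mod2_eq_one_iff.1 hA2)
  have hmem := (isFormChain_chainVec s).affineEquiv_two_smul_mem
    (H := (rhoOdd s).range.map (glEquiv ℤ _).toMonoidHom) span_chainVec_add_one
    (fun i hi => ⟨_, ⟨_, rfl⟩, glEquiv_rhoOdd_of ⟨i + 1, by omega⟩⟩) span_chainVec
    ⟨_, ⟨_, rfl⟩, glEquiv_rhoOdd_of ⟨0, by omega⟩⟩ hT hT2 u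
  rw [hTy] at hmem
  exact (Subgroup.mem_map_iff_mem (glEquiv ℤ _).injective).1 hmem

end Image

section Index

variable {n : ℕ} {ι : Type} [Fintype ι] [DecidableEq ι]

theorem card_map_mod2_mul_relIndex {G A : Subgroup (GL ι ℤ)} (hGA : G ≤ A)
    (hA : principalCongruence A ≤ G) :
    Nat.card (G.map (mod2 ι)) * G.relIndex A = Nat.card (A.map (mod2 ι)) := by
  have hker : ∀ K : Subgroup (GL ι ℤ), (principalCongruence K).relIndex K =
      Nat.card (K.map (mod2 ι)) := fun K => by
    rw [principalCongruence, inf_comm, Subgroup.inf_relIndex_right, Subgroup.relIndex_ker]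
  have hG : principalCongruence A ⊓ G = principalCongruence G := by
    rw [principalCongruence, inf_right_comm, inf_eq_right.2 hGA, principalCongruence]
  rw [← hker, ← hker, ← hG, Subgroup.inf_relIndex_right,
    Subgroup.relIndex_mul_relIndex _ _ _ hA hGA]

theorem exists_range_mod2_comp_rhoMatrix_mulEquiv_perm (hn : 2 ≤ n)
    (c : (Fin n → ℤ) ≃ₗ[ℤ] (ι → ℤ)) :
    ∃ e : ((mod2 ι).comp (rhoMatrix c)).range ≃* Equiv.Perm (Fin (n + 1)), ∀ i : Fin n,
      e ⟨mod2 ι (rhoMatrix c (PresentedGroup.of i)), PresentedGroup.of i, rfl⟩ =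
        Equiv.swap i.castSucc i.succ := by
  obtain ⟨e, he⟩ := exists_mulEquiv_of_ker_eq (f := (mod2 ι).comp (rhoMatrix c))
    (braidPerm_surjective n) (Subgroup.ext (mod2_rhoMatrix_eq_one_iff_braidPerm hn c))
  exact ⟨e, fun i => (he _).trans (braidPerm_of i)⟩

theorem card_map_mod2_range_rhoMatrix (hn : 2 ≤ n) (c : (Fin n → ℤ) ≃ₗ[ℤ] (ι → ℤ)) :
    Nat.card ((rhoMatrix c).range.map (mod2 ι)) = Nat.factorial (n + 1) := by
  obtain ⟨e, -⟩ := exists_range_mod2_comp_rhoMatrix_mulEquiv_perm hn c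
  rw [MonoidHom.map_range, Nat.card_congr e.toEquiv, Nat.card_perm, Nat.card_fin]

theorem relIndex_range_rhoMatrix (hn : 2 ≤ n) (c : (Fin n → ℤ) ≃ₗ[ℤ] (ι → ℤ))
    {A : Subgroup (GL ι ℤ)} (hGA : (rhoMatrix c).range ≤ A)
    (hA : principalCongruence A ≤ (rhoMatrix c).range) :
    ((rhoMatrix c).range.relIndex A : ℚ) =
      Nat.card (A.map (mod2 ι)) / Nat.factorial (n + 1) := by
  rw [eq_div_iff (by positivity), ← card_map_mod2_mul_relIndex hGA hA,
    card_map_mod2_range_rhoMatrix hn, Nat.cast_mul, mul_comm]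

end Index

end BraidSymplectic

open BraidSymplectic in
theorem mainTheorem4 (s : ℕ) (hs : 1 ≤ s) :
    -- the case of even dimension `n = 2s`
    ((rhoEven s).range ≤ Sp s ∧
      (∃ e : ((mod2 (Fin s ⊕ Fin s)).comp (rhoEven s)).range ≃* Equiv.Perm (Fin (2 * s + 1)),
        ∀ i : Fin (2 * s),
          e ⟨mod2 (Fin s ⊕ Fin s) (rhoEven s (PresentedGroup.of i)), ⟨PresentedGroup.of i, rfl⟩⟩
            = Equiv.swap i.castSucc i.succ) ∧
      principalCongruence (Sp s) ≤ (rhoEven s).range ∧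
      ((rhoEven s).range.relIndex (Sp s) : ℚ) =
        2 ^ (s ^ 2) * (∏ k ∈ Finset.Icc 1 s, ((2 : ℚ) ^ (2 * k) - 1)) /
          (Nat.factorial (2 * s + 1) : ℚ)) ∧
    -- the case of odd dimension `n = 2s + 1`
    ((rhoOdd s).range ≤ SpAffine s ∧
      (∃ e : ((mod2 ((Fin s ⊕ Fin s) ⊕ Unit)).comp (rhoOdd s)).range ≃*
          Equiv.Perm (Fin (2 * s + 2)),
        ∀ i : Fin (2 * s + 1),
          e ⟨mod2 ((Fin s ⊕ Fin s) ⊕ Unit) (rhoOdd s (PresentedGroup.of i)),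
              ⟨PresentedGroup.of i, rfl⟩⟩
            = Equiv.swap i.castSucc i.succ) ∧
      principalCongruence (SpAffine s) ≤ (rhoOdd s).range ∧
      ((rhoOdd s).range.relIndex (SpAffine s) : ℚ) =
        2 ^ (s ^ 2 + 2 * s) * (∏ k ∈ Finset.Icc 1 s, ((2 : ℚ) ^ (2 * k) - 1)) /
          (Nat.factorial (2 * s + 2) : ℚ)) := by
  have hn : 2 ≤ 2 * s := by omega
  refine ⟨⟨range_rhoEven_le s, exists_range_mod2_comp_rhoMatrix_mulEquiv_perm hn _,
    principalCongruence_Sp_le s, ?_⟩, range_rhoOdd_le s,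
    exists_range_mod2_comp_rhoMatrix_mulEquiv_perm (Nat.le_succ_of_le hn) _,
    principalCongruence_SpAffine_le s, ?_⟩
  · rw [← cast_card_map_Sp]
    exact relIndex_range_rhoMatrix hn _ (range_rhoEven_le s) (principalCongruence_Sp_le s)
  · rw [← cast_card_map_SpAffine]
    exact relIndex_range_rhoMatrix (Nat.le_succ_of_le hn) _ (range_rhoOdd_le s)
      (principalCongruence_SpAffine_le s)
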